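/- Let $\mathbb F=\mathbb F_2$, let $\mathcal P$ be a symmetric operad in $\mathbb F$-vector spaces, and let $\star\in\mathcal P(2)^{\Sigma_2}$ be a commutative operation that is $\mathcal P$-central, i.e. satisfies the interchange law $$\star\big(\mu(x_1,\dots,x_n),\mu(y_1,\dots,y_n)\big)=\mu\big(\star(x_1,y_1),\dots,\star(x_n,y_n)\big)$$ for all $n\ge 0$ and $\mu\in\mathcal P(n)$ (as an identity of operations in $\mathcal P(2n)$). An unstable module is a graded module $M=\bigoplus_{d\ge0}M^d$ over the mod 2 Steenrod algebra with $Sq^ix=0$ for $i>|x|$; put $Sq_0x=Sq^{|x|}x$. $M$ is connected if $M^0=0$ and reduced if $Sq_0$ is injective. Let $\Sigma$ be the suspension and $\Omega M=\Sigma^{-1}(M/\operatorname{Im}Sq_0)$, so that $\Sigma\Omega M=M/\operatorname{Im}Sq_0$, with projection $pr:M\to\Sigma\Omega M$. A graded section of $M$ is a degree-preserving linear map $s:\Sigma\Omega M\to M$ with $pr\circ s=\mathrm{id}$. For a graded vector space $V$ let $S(\mathcal P,V)=\bigoplus_n\mathcal P(n)\otimes_{\Sigma_n}V^{\otimes n}$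 be the free graded $\mathcal P$-algebra on $V$. The operations $Sq^i$ act on $S(\mathcal P,M)$ by the Cartan formula, and the free $\star$-unstable $\mathcal P$-algebra on $M$ is $$K_{\mathcal P}^\star(M)=S(\mathcal P,M)/I,$$ where $I$ is the smallest graded $\mathcal P$-ideal that is stable under all $Sq^i$ and contains $Sq_0\mathfrak t+\star(\mathfrak t,\mathfrak t)$ for all homogeneous $\mathfrak t\in S(\mathcal P,M)$. (1) For every connected reduced unstable module $M$, the graded $\mathcal P$-algebras $K_{\mathcal P}^\star(M)$ and $S(\mathcal P,\Sigma\Omega M)$ are isomorphic. More precisely, $M$ has a graded section, and for every graded section $s$ there is exactly one isomorphism of graded $\mathcal P$-algebras $\hat\varphi_s:K_{\mathcal P}^\star(M)\to S(\mathcal P,\Sigma\Omega M)$ whose inverse sends each generator $b\in\Sigma\Omega M$ to the class $[s(b)]$. (2) Suppose that $\star$ is not of the form $\mu+\mu\cdot(1\,2)$ with $\mu\in\mathcal P(2)$ (that is, $\star$ is non-zero in the coinvariants $\mathcal P(2)_{\Sigma_2}$). Then there is no family of isomorphisms of graded $\mathcal P$-algebras $K_{\mathcal P}^\star(M)\cong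 S(\mathcal P,\Sigma\Omega M)$ that is natural in the connected reduced unstable module $M$; and the isomorphism $\hat\varphi_s$ depends on the choice of $s$: there are a connected reduced $M$ and graded sections $s,s'$ of $M$ with $\hat\varphi_s\ne\hat\varphi_{s'}$. -/

import Mathlib

universe u v w

noncomputable section

namespace UnstableOperad

open scoped TensorProduct


/-- The field with two elements. -/
abbrev F2 : Type := ZMod 2

/-! ### Multilinear algebra -/

theorem multilinear_mem_of_span {ι : Type*} [Finite ι] {W : ι → Type*} {Z : Type*}
    [∀ i, AddCommGroup (W i)] [∀ i, Module F2 (W i)] [AddCommGroup Z] [Module F2 Z]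
    (f : MultilinearMap F2 W Z) (G : ∀ i, Set (W i)) (T : Submodule F2 Z)
    (h : ∀ x : ∀ i, W i, (∀ i, x i ∈ G i) → f x ∈ T)
    (x : ∀ i, W i) (hx : ∀ i, x i ∈ Submodule.span F2 (G i)) : f x ∈ T := by
  classical
  cases nonempty_fintype ι
  suffices H : ∀ s : Finset ι, ∀ x : ∀ i, W i, (∀ i ∈ s, x i ∈ Submodule.span F2 (G i)) →
      (∀ i ∉ s, x i ∈ G i) → f x ∈ T from
    H Finset.univ x (fun i _ => hx i) (fun i hi => absurd (Finset.mem_univ i) hi)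
  intro s
  induction s using Finset.induction_on with
  | empty => intro x _ hx; exact h x (fun i => hx i (Finset.notMem_empty i))
  | insert i s his ih =>
    intro x hx1 hx2
    have key : ∀ w ∈ Submodule.span F2 (G i), f (Function.update x i w) ∈ T := by
      intro w hw
      induction hw using Submodule.span_induction with
      | mem w hw =>
        apply ih
        · intro j hj
          rw [Function.update_of_ne (ne_of_mem_of_not_mem hj his)]
          exact hx1 j (Finset.mem_insert_of_mem hj)
        · intro j hj
          by_cases hji : j = i
          · subst hji; simpa using hw
          · rw [Function.update_of_ne hji]
            exact hx2 j (by simp [hji, hj])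
      | zero => simp
      | add a b _ _ ha hb => rw [f.map_update_add]; exact T.add_mem ha hb
      | smul c a _ ha => rw [f.map_update_smul]; exact T.smul_mem c ha
    simpa using key (x i) (hx1 i (Finset.mem_insert_self i s))

theorem multilinear_ext_of_span {ι : Type*} [Finite ι] {W : ι → Type*} {Z : Type*}
    [∀ i, AddCommGroup (W i)] [∀ i, Module F2 (W i)] [AddCommGroup Z] [Module F2 Z]
    {X : ι → Type*} (g : ∀ i, X i → W i) (hg : ∀ i, Submodule.span F2 (Set.range (g i)) = ⊤)
    {f f' : MultilinearMap F2 W Z}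
    (h : ∀ x : ∀ i, X i, f (fun i => g i (x i)) = f' (fun i => g i (x i))) : f = f' := by
  ext x
  rw [← sub_eq_zero, ← sub_apply, ← Submodule.mem_bot F2]
  refine multilinear_mem_of_span _ (fun i => Set.range (g i)) ⊥ ?_ x
    (fun i => by rw [hg]; trivial)
  intro y hy
  choose z hz using hy
  obtain rfl : (fun i => g i (z i)) = y := funext hz
  simp [h z]

/-- A function on tuples of generators extends to a multilinear map as soon as it extends linearly
in each variable separately. -/
theorem exists_multilinear {ι : Type*} [Finite ι] [DecidableEq ι] {W : ι → Type*} {Z : Type*}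
    [∀ i, AddCommGroup (W i)] [∀ i, Module F2 (W i)] [AddCommGroup Z] [Module F2 Z]
    {X : ι → Type*} (g : ∀ i, X i → W i) (hg : ∀ i, Submodule.span F2 (Set.range (g i)) = ⊤)
    (f : (∀ i, X i) → Z)
    (h : ∀ i x, ∃ L : W i →ₗ[F2] Z, ∀ a, L (g i a) = f (Function.update x i a)) :
    ∃ F : MultilinearMap F2 W Z, ∀ x, F (fun i => g i (x i)) = f x := by
  classical
  cases nonempty_fintype ι
  let q : ∀ i, (X i →₀ F2) →ₗ[F2] W i := fun i => Finsupp.linearCombination F2 (g i)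
  have hq : ∀ i, Function.Surjective (q i) := fun i => by
    rw [← LinearMap.range_eq_top, Finsupp.range_linearCombination, hg]
  choose s hs using fun i => (q i).exists_rightInverse_of_surjective
    (LinearMap.range_eq_top.2 (hq i))
  have hs' : ∀ i w, q i (s i w) = w := fun i w => LinearMap.congr_fun (hs i) w
  obtain ⟨Ft, hFt⟩ : ∃ Ft : MultilinearMap F2 (fun i => X i →₀ F2) Z,
      ∀ x : ∀ i, X i, Ft (fun i => Finsupp.single (x i) 1) = f x := by
    refine ⟨(Finsupp.linearCombination F2 f).compMultilinearMap
      (((PiTensorProduct.ofFinsuppEquiv' (R := F2) (κ := X)).toLinearMap).compMultilinearMap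
        (PiTensorProduct.tprod F2)), fun x => ?_⟩
    simp [PiTensorProduct.ofFinsuppEquiv'_tprod_single]
  have key : ∀ i, Ft.compLinearMap
      (Function.update (fun _ => LinearMap.id) i (LinearMap.id - s i ∘ₗ q i)) = 0 := by
    intro i
    refine Module.Basis.ext_multilinear (fun i => Finsupp.basisSingleOne) (fun x => ?_)
    have e1 : ∀ r, Ft (Function.update (fun j => Finsupp.single (x j) 1) i r) =
        Finsupp.linearCombination F2 (fun a => f (Function.update x i a)) r := by
      intro r
      have : Ft.toLinearMap (fun j => Finsupp.single (x j) 1) i =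
          Finsupp.linearCombination F2 (fun a => f (Function.update x i a)) := by
        refine Finsupp.lhom_ext' (fun a => LinearMap.ext_ring ?_)
        simp only [LinearMap.comp_apply, Finsupp.lsingle_apply, MultilinearMap.toLinearMap_apply,
          Finsupp.linearCombination_single, one_smul]
        rw [← hFt]
        congr 1
        funext j
        by_cases hj : j = i
        · subst hj; simp
        · simp [hj]
      exact LinearMap.congr_fun this r
    obtain ⟨L, hL⟩ := h i x
    have e2 : ∀ r, Finsupp.linearCombination F2 (fun a => f (Function.update x i a)) r
        = L (q i r) := by
      intro r
      simp [q, Finsupp.linearCombination_apply, Finsupp.sum, map_sum, hL]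
    have e3 : (fun j => (Function.update (fun _ => LinearMap.id) i
        (LinearMap.id - s i ∘ₗ q i) : ∀ j, (X j →₀ F2) →ₗ[F2] (X j →₀ F2)) j
          (Finsupp.single (x j) 1))
        = Function.update (fun j => Finsupp.single (x j) 1) i
          (Finsupp.single (x i) 1 - s i (q i (Finsupp.single (x i) 1))) := by
      funext j
      by_cases hj : j = i
      · subst hj; simp
      · simp [hj]
    simp only [Finsupp.coe_basisSingleOne, MultilinearMap.compLinearMap_apply,
      zero_apply]
    rw [e3, e1, e2, map_sub, hs', sub_self, map_zero]
  have key2 : ∀ (t : Finset ι) c, Ft c = Ft (fun i => if i ∈ t then s i (q i (c i)) else c i) := by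
    intro t c
    induction t using Finset.induction_on with
    | empty => simp
    | insert i t hit ih =>
      rw [ih]
      set c' : ∀ i, X i →₀ F2 := fun i => if i ∈ t then s i (q i (c i)) else c i with hc'
      have h1 := congrArg (fun F => F c') (key i)
      have e3 : (fun j => (Function.update (fun _ => LinearMap.id) i
        (LinearMap.id - s i ∘ₗ q i) : ∀ j, (X j →₀ F2) →ₗ[F2] (X j →₀ F2)) j (c' j))
        = Function.update c' i (c' i - s i (q i (c' i))) := by
        funext j
        by_cases hj : j = i
        · subst hj; simp
        · simp [hj]
      simp only [MultilinearMap.compLinearMap_apply, zero_apply] at h1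
      rw [e3, MultilinearMap.map_update_sub, Function.update_eq_self, sub_eq_zero] at h1
      rw [h1]
      congr 1
      funext j
      by_cases hj : j = i
      · subst hj; simp [hc', hit]
      · simp [hj, hc']
  refine ⟨Ft.compLinearMap s, fun x => ?_⟩
  rw [← hFt, key2 Finset.univ]
  simp [q]


/-! ### Symmetric operads -/

/-- The bijection of `Fin (k 1 + ... + k n)` with `Fin (l 1 + ... + l n)` that applies `e i` to the
`i`-th block. -/
def blockSum {n : ℕ} {k l : Fin n → ℕ} (e : ∀ i, Fin (k i) ≃ Fin (l i)) :
    Fin (∑ i, k i) ≃ Fin (∑ i, l i) :=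
  finSigmaFinEquiv.symm.trans ((Equiv.sigmaCongrRight e).trans finSigmaFinEquiv)

/-- The bijection that permutes blocks of sizes `k j` according to `σ`: the `i`-th block on the
left is sent to the `σ i`-th block on the right. -/
def blockPerm {n m : ℕ} (σ : Fin n ≃ Fin m) (k : Fin m → ℕ) :
    Fin (∑ i, k (σ i)) ≃ Fin (∑ j, k j) :=
  finSigmaFinEquiv.symm.trans
    ((Equiv.sigmaCongrLeft (β := fun j => Fin (k j)) σ).trans finSigmaFinEquiv)

/-- The order preserving bijection between the two ways to enumerate blocks of blocks. -/
def blockAssoc {n : ℕ} (k : Fin n → ℕ) (l : ∀ i, Fin (k i) → ℕ) :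
    Fin (∑ a : Fin (∑ i, k i), l (finSigmaFinEquiv.symm a).1 (finSigmaFinEquiv.symm a).2) ≃
      Fin (∑ i, ∑ j, l i j) :=
  finSigmaFinEquiv.symm.trans
    ((Equiv.sigmaCongrLeft (β := fun p : (i : Fin n) × Fin (k i) => Fin (l p.1 p.2))
        finSigmaFinEquiv.symm).trans
      ((Equiv.sigmaAssoc (fun i j => Fin (l i j))).trans
        ((Equiv.sigmaCongrRight (fun _ => finSigmaFinEquiv)).trans finSigmaFinEquiv)))

theorem blockAssoc_apply {n : ℕ} (k : Fin n → ℕ) (l : ∀ i, Fin (k i) → ℕ)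
    (t : Fin (∑ i, k i)) (j : Fin (l (finSigmaFinEquiv.symm t).1 (finSigmaFinEquiv.symm t).2)) :
    blockAssoc k l (finSigmaFinEquiv ⟨t, j⟩) = finSigmaFinEquiv
      ⟨(finSigmaFinEquiv.symm t).1, finSigmaFinEquiv ⟨(finSigmaFinEquiv.symm t).2, j⟩⟩ := by
  simp only [blockAssoc, Equiv.trans_apply]
  rw [Equiv.symm_apply_apply]
  rfl

/-- The order preserving bijection of `Fin n` with one block of size `n`. -/
def oneBlock (n : ℕ) : Fin n ≃ Fin (∑ _i : Fin 1, n) :=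
  (Equiv.uniqueSigma (fun _ : Fin 1 => Fin n)).symm.trans finSigmaFinEquiv

/-- The order preserving bijection of `Fin n` with `n` blocks of size one. -/
def unitBlocks (n : ℕ) : Fin n ≃ Fin (∑ _i : Fin n, 1) :=
  (Equiv.sigmaUnique (Fin n) (fun _ => Fin 1)).symm.trans finSigmaFinEquiv

/-- The bijection from `n` blocks of size `m` to `m` blocks of size `n`, which sends the `j`-th
element of the `i`-th block to the `i`-th element of the `j`-th block. For `m = 2` and counting
from `1` it is `2i - 1 ↦ i`, `2i ↦ n + i`. -/
def blockTranspose (n m : ℕ) : Fin (∑ _i : Fin n, m) ≃ Fin (∑ _j : Fin m, n) :=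
  finSigmaFinEquiv.symm.trans
    ((Equiv.sigmaEquivProd (Fin n) (Fin m)).trans
      ((Equiv.prodComm (Fin n) (Fin m)).trans
        ((Equiv.sigmaEquivProd (Fin m) (Fin n)).symm.trans finSigmaFinEquiv)))

/-- The concatenation of `n` tuples of lengths `k 1, …, k n`. -/
def flatten {n : ℕ} {k : Fin n → ℕ} {β : Type*} (x : ∀ i, Fin (k i) → β) :
    Fin (∑ i, k i) → β :=
  fun t => x (finSigmaFinEquiv.symm t).1 (finSigmaFinEquiv.symm t).2

theorem flatten_apply {n : ℕ} {k : Fin n → ℕ} {β : Type*} (x : ∀ i, Fin (k i) → β)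
    (p : (i : Fin n) × Fin (k i)) : flatten x (finSigmaFinEquiv p) = x p.1 p.2 := by
  unfold flatten
  rw [Equiv.symm_apply_apply]

/-- A symmetric operad in `F2`-vector spaces. The underlying symmetric sequence is a functor on the
groupoid whose objects are the natural numbers and whose morphisms from `m` to `n` are the
bijections `Fin m ≃ Fin n` (there are none unless `m = n`): `relabel e μ` is the operation `μ` with
its `i`-th input renamed to `e i`. In terms of right actions of the symmetric groups,
`relabel σ μ` is `μ · σ⁻¹`. The composite `comp k μ ν` is `μ(ν₁, …, νₙ)`, with inputs in
lexicographic order. -/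
structure Operad where
  obj : ℕ → Type u
  [addCommGroup : ∀ n, AddCommGroup (obj n)]
  [module : ∀ n, Module F2 (obj n)]
  relabel : ∀ {m n : ℕ}, (Fin m ≃ Fin n) → obj m →ₗ[F2] obj n
  relabel_refl : ∀ {n : ℕ} (μ : obj n), relabel (Equiv.refl (Fin n)) μ = μ
  relabel_trans : ∀ {l m n : ℕ} (e : Fin l ≃ Fin m) (e' : Fin m ≃ Fin n) (μ : obj l),
    relabel (e.trans e') μ = relabel e' (relabel e μ)
  one : obj 1
  comp : ∀ {n : ℕ} (k : Fin n → ℕ),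
    obj n →ₗ[F2] MultilinearMap F2 (fun i => obj (k i)) (obj (∑ i, k i))
  relabel_comp : ∀ {n m : ℕ} (σ : Fin n ≃ Fin m) (k : Fin m → ℕ) (μ : obj n)
    (ν : ∀ j, obj (k j)),
    comp k (relabel σ μ) ν = relabel (blockPerm σ k) (comp (fun i => k (σ i)) μ (fun i => ν (σ i)))
  comp_relabel : ∀ {n : ℕ} {k l : Fin n → ℕ} (e : ∀ i, Fin (k i) ≃ Fin (l i)) (μ : obj n)
    (ν : ∀ i, obj (k i)),
    comp l μ (fun i => relabel (e i) (ν i)) = relabel (blockSum e) (comp k μ ν)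
  one_comp : ∀ {n : ℕ} (ν : obj n), comp (fun _ => n) one (fun _ => ν) = relabel (oneBlock n) ν
  comp_one : ∀ {n : ℕ} (μ : obj n), comp (fun _ => 1) μ (fun _ => one) = relabel (unitBlocks n) μ
  comp_comp : ∀ {n : ℕ} (k : Fin n → ℕ) (l : ∀ i, Fin (k i) → ℕ) (μ : obj n)
    (ν : ∀ i, obj (k i)) (ξ : ∀ i j, obj (l i j)),
    relabel (blockAssoc k l)
        (comp (fun a => l (finSigmaFinEquiv.symm a).1 (finSigmaFinEquiv.symm a).2) (comp k μ ν)
          (fun a => ξ (finSigmaFinEquiv.symm a).1 (finSigmaFinEquiv.symm a).2)) =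
      comp (fun i => ∑ j, l i j) μ (fun i => comp (l i) (ν i) (ξ i))

attribute [instance] Operad.addCommGroup Operad.module

/-- `star` is fixed by the symmetric group on two letters. -/
def Operad.IsCommutative (P : Operad.{u}) (star : P.obj 2) : Prop :=
  ∀ σ : Fin 2 ≃ Fin 2, P.relabel σ star = star

/-- The interchange law
`star(μ(x₁, …, xₙ), μ(y₁, …, yₙ)) = μ(star(x₁, y₁), …, star(xₙ, yₙ))` for all operations `μ`. -/
def Operad.IsCentral (P : Operad.{u}) (star : P.obj 2) : Prop :=
  ∀ (n : ℕ) (μ : P.obj n),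
    P.comp (fun _ : Fin 2 => n) star (fun _ => μ) =
      P.relabel (blockTranspose n 2) (P.comp (fun _ : Fin n => 2) μ (fun _ => star))

/-! ### Algebras over an operad -/

/-- The structure of an algebra over the operad `P` on the vector space `A`. -/
structure PAlgebra (P : Operad.{u}) (A : Type v) [AddCommGroup A] [Module F2 A] where
  act : ∀ {n : ℕ}, P.obj n →ₗ[F2] MultilinearMap F2 (fun _ : Fin n => A) A
  act_relabel : ∀ {m n : ℕ} (e : Fin m ≃ Fin n) (μ : P.obj m) (x : Fin n → A),
    act (P.relabel e μ) x = act μ (fun i => x (e i))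
  act_one : ∀ x : Fin 1 → A, act P.one x = x 0
  act_comp : ∀ {n : ℕ} (k : Fin n → ℕ) (μ : P.obj n) (ν : ∀ i, P.obj (k i))
    (x : Fin (∑ i, k i) → A),
    act (P.comp k μ ν) x = act μ (fun i => act (ν i) (fun j => x (finSigmaFinEquiv ⟨i, j⟩)))

/-! ### The Schur functor and the free algebra -/

section Schur

variable (P : Operad.{u}) (V : Type v) [AddCommGroup V] [Module F2 V]

/-- The relations `μ·σ ⊗ x = μ ⊗ σ·x` defining the coinvariants `P(n) ⊗_{Σₙ} V^{⊗ n}`. -/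
def coinvRel (n : ℕ) : Submodule F2 (P.obj n ⊗[F2] (⨂[F2] _i : Fin n, V)) :=
  Submodule.span F2 {t | ∃ (σ : Fin n ≃ Fin n) (μ : P.obj n) (x : Fin n → V),
    t = P.relabel σ μ ⊗ₜ PiTensorProduct.tprod F2 x
      - μ ⊗ₜ PiTensorProduct.tprod F2 (fun i => x (σ i))}

/-- The Schur functor `S(P, V) = ⨁ₙ P(n) ⊗_{Σₙ} V^{⊗ n}`. -/
def Schur : Type (max u v) :=
  DirectSum ℕ (fun n => (P.obj n ⊗[F2] (⨂[F2] _i : Fin n, V)) ⧸ coinvRel P V n)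

instance Schur.instAddCommGroup : AddCommGroup (Schur P V) :=
  inferInstanceAs (AddCommGroup
    (DirectSum ℕ (fun n => (P.obj n ⊗[F2] (⨂[F2] _i : Fin n, V)) ⧸ coinvRel P V n)))

instance Schur.instModule : Module F2 (Schur P V) :=
  inferInstanceAs (Module F2
    (DirectSum ℕ (fun n => (P.obj n ⊗[F2] (⨂[F2] _i : Fin n, V)) ⧸ coinvRel P V n)))

variable {P V}

variable (P V) in
/-- The inclusion of the summand of arity `n`. -/
def Schur.incl (n : ℕ) :
    ((P.obj n ⊗[F2] (⨂[F2] _i : Fin n, V)) ⧸ coinvRel P V n) →ₗ[F2] Schur P V :=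
  DirectSum.lof F2 ℕ (fun n => (P.obj n ⊗[F2] (⨂[F2] _i : Fin n, V)) ⧸ coinvRel P V n) n

/-- The element `(μ; x₁, …, xₙ)` of `S(P, V)`. -/
def Schur.mk {n : ℕ} (μ : P.obj n) (x : Fin n → V) : Schur P V :=
  Schur.incl P V n ((coinvRel P V n).mkQ (μ ⊗ₜ PiTensorProduct.tprod F2 x))

/-- Generators of the Schur functor, bundled with their arity. -/
def Schur.gen (a : (n : ℕ) × P.obj n × (Fin n → V)) : Schur P V := Schur.mk a.2.1 a.2.2

theorem Schur.mk_add {n : ℕ} (μ ν : P.obj n) (x : Fin n → V) :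
    Schur.mk (μ + ν) x = Schur.mk μ x + Schur.mk ν x := by
  simp only [Schur.mk, TensorProduct.add_tmul, map_add]

theorem Schur.mk_update_add {n : ℕ} (μ : P.obj n) (x : Fin n → V) (i : Fin n) (v w : V) :
    Schur.mk μ (Function.update x i (v + w)) =
      Schur.mk μ (Function.update x i v) + Schur.mk μ (Function.update x i w) := by
  simp only [Schur.mk, MultilinearMap.map_update_add, TensorProduct.tmul_add, map_add]

theorem Schur.mk_relabel {m n : ℕ} (e : Fin m ≃ Fin n) (μ : P.obj m) (x : Fin n → V) :
    Schur.mk (P.relabel e μ) x = Schur.mk μ (fun i => x (e i)) := by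
  obtain rfl : m = n := by simpa using Fintype.card_congr e
  unfold Schur.mk
  congr 1
  rw [← sub_eq_zero, ← map_sub, Submodule.mkQ_apply, Submodule.Quotient.mk_eq_zero]
  exact Submodule.subset_span ⟨e, μ, x, rfl⟩

theorem Schur.span_gen :
    Submodule.span F2 (Set.range (Schur.gen (P := P) (V := V))) = ⊤ := by
  rw [eq_top_iff]
  rintro t -
  refine DirectSum.induction_on
    (motive := fun t : Schur P V => t ∈ Submodule.span F2 (Set.range Schur.gen)) t
    (Submodule.zero_mem _) (fun n t => ?_) (fun a b ha hb => Submodule.add_mem _ ha hb)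
  change Schur.incl P V n t ∈ _
  obtain ⟨t, rfl⟩ := Submodule.mkQ_surjective _ t
  induction t using TensorProduct.induction_on with
  | zero => simp
  | add a b ha hb => rw [map_add, map_add]; exact Submodule.add_mem _ ha hb
  | tmul μ x =>
    induction x using PiTensorProduct.induction_on with
    | smul_tprod r x =>
      rw [TensorProduct.tmul_smul, map_smul, map_smul]
      exact Submodule.smul_mem _ _ (Submodule.subset_span ⟨⟨n, μ, x⟩, rfl⟩)
    | add a b ha hb =>
      rw [TensorProduct.tmul_add, map_add, map_add]; exact Submodule.add_mem _ ha hb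

theorem Schur.linear_ext {Z : Type w} [AddCommGroup Z] [Module F2 Z] {f g : Schur P V →ₗ[F2] Z}
    (h : ∀ (n : ℕ) (μ : P.obj n) (x : Fin n → V), f (Schur.mk μ x) = g (Schur.mk μ x)) : f = g :=
  LinearMap.ext_on_range Schur.span_gen (fun a => h a.1 a.2.1 a.2.2)

theorem map_smul_of_add {A : Type v} {Z : Type w} [AddCommGroup A] [Module F2 A] [AddCommGroup Z]
    [Module F2 Z] (f : A → Z) (h : ∀ a b, f (a + b) = f a + f b) (c : F2) (a : A) :
    f (c • a) = c • f a :=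
  ((AddMonoidHom.mk' f h).toZModLinearMap 2).map_smul c a

/-- Linear maps out of `S(P, V)` are given by multilinear equivariant families. -/
theorem Schur.exists_lift {Z : Type w} [AddCommGroup Z] [Module F2 Z]
    (f : ∀ n : ℕ, P.obj n → (Fin n → V) → Z)
    (h1 : ∀ n μ ν x, f n (μ + ν) x = f n μ x + f n ν x)
    (h2 : ∀ n μ x i v w, f n μ (Function.update x i (v + w)) =
      f n μ (Function.update x i v) + f n μ (Function.update x i w))
    (h3 : ∀ n (σ : Fin n ≃ Fin n) μ x, f n (P.relabel σ μ) x = f n μ (fun i => x (σ i))) :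
    ∃ L : Schur P V →ₗ[F2] Z, ∀ n (μ : P.obj n) (x : Fin n → V), L (Schur.mk μ x) = f n μ x := by
  let φ : ∀ n, P.obj n → MultilinearMap F2 (fun _ : Fin n => V) Z := fun n μ =>
    { toFun := f n μ
      map_update_add' := fun {dec} x i v w => by
        rw [Subsingleton.elim dec (instDecidableEqFin n)]; exact h2 n μ x i v w
      map_update_smul' := fun {dec} x i c v => by
        rw [Subsingleton.elim dec (instDecidableEqFin n)]
        exact map_smul_of_add
          (fun v => f n μ (@Function.update _ _ (instDecidableEqFin n) x i v)) (h2 n μ x i) c v }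
  have hφ : ∀ n μ ν, φ n (μ + ν) = φ n μ + φ n ν := fun n μ ν =>
    MultilinearMap.ext (fun x => h1 n μ ν x)
  let Φ : ∀ n, P.obj n →ₗ[F2] ((⨂[F2] _i : Fin n, V) →ₗ[F2] Z) := fun n =>
    (PiTensorProduct.lift (R := F2) (s := fun _ : Fin n => V) (E := Z)).toLinearMap ∘ₗ
      { toFun := φ n, map_add' := hφ n, map_smul' := map_smul_of_add (φ n) (hφ n) }
  have hΦ : ∀ n μ x, TensorProduct.lift (Φ n) (μ ⊗ₜ PiTensorProduct.tprod F2 x) = f n μ x := by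
    intro n μ x
    simp [Φ, φ]
  have hker : ∀ n, coinvRel P V n ≤ LinearMap.ker (TensorProduct.lift (Φ n)) := by
    intro n
    rw [coinvRel, Submodule.span_le]
    rintro _ ⟨σ, μ, x, rfl⟩
    simp only [SetLike.mem_coe, LinearMap.mem_ker, map_sub, hΦ, h3, sub_self]
  refine ⟨DirectSum.toModule F2 ℕ Z
    (fun n => (coinvRel P V n).liftQ (TensorProduct.lift (Φ n)) (hker n)), fun n μ x => ?_⟩
  refine (DirectSum.toModule_lof (R := F2) (ι := ℕ) (N := Z)
    (φ := fun n => (coinvRel P V n).liftQ (TensorProduct.lift (Φ n)) (hker n)) n _).trans ?_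
  rw [Submodule.mkQ_apply, Submodule.liftQ_apply, hΦ]

/-- The composite of `μ` with generators `(ν₁; x₁), …, (νₙ; xₙ)` of `S(P, V)`. -/
def Schur.compGen {n : ℕ} (μ : P.obj n) (a : Fin n → (m : ℕ) × P.obj m × (Fin m → V)) :
    Schur P V :=
  Schur.mk (P.comp (fun i => (a i).1) μ (fun i => (a i).2.1))
    (flatten fun i => (a i).2.2)

theorem Schur.exists_act {n : ℕ} (μ : P.obj n) :
    ∃ F : MultilinearMap F2 (fun _ : Fin n => Schur P V) (Schur P V),
      ∀ a : Fin n → (m : ℕ) × P.obj m × (Fin m → V),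
        F (fun i => Schur.gen (a i)) = Schur.compGen μ a := by
  refine exists_multilinear (W := fun _ : Fin n => Schur P V) (fun _ => Schur.gen)
    (fun _ => Schur.span_gen) _ (fun i a => ?_)
  have hrep : ∀ m : ℕ, ∃ (k : Fin n → ℕ) (ν : ∀ j, P.obj (k j)) (x : ∀ j, Fin (k j) → V),
      k i = m ∧ ∀ j, j ≠ i → a j = ⟨k j, ν j, x j⟩ := by
    intro m
    refine ⟨fun j => (Function.update a i ⟨m, 0, 0⟩ j).1,
      fun j => (Function.update a i ⟨m, 0, 0⟩ j).2.1,
      fun j => (Function.update a i ⟨m, 0, 0⟩ j).2.2, by simp, fun j hj => by simp [hj]⟩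
  have hupd : ∀ (k : Fin n → ℕ) (ν : ∀ j, P.obj (k j)) (x : ∀ j, Fin (k j) → V)
      (_ : ∀ j, j ≠ i → a j = ⟨k j, ν j, x j⟩) (ν' : P.obj (k i)) (y : Fin (k i) → V),
      Schur.compGen μ (Function.update a i ⟨k i, ν', y⟩) =
        Schur.mk (P.comp k μ (Function.update ν i ν'))
          (flatten (Function.update x i y)) := by
    intro k ν x h ν' y
    have : Function.update a i ⟨k i, ν', y⟩ =
        fun j => ⟨k j, Function.update ν i ν' j, Function.update x i y j⟩ := by
      funext j
      by_cases hj : j = i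
      · subst hj; simp
      · simp [hj, h j hj]
    rw [this]
    rfl
  suffices H : ∃ L : Schur P V →ₗ[F2] Schur P V, ∀ m (ν : P.obj m) (y : Fin m → V),
      L (Schur.mk ν y) = Schur.compGen μ (Function.update a i ⟨m, ν, y⟩) by
    obtain ⟨L, hL⟩ := H
    exact ⟨L, fun b => hL b.1 b.2.1 b.2.2⟩
  refine Schur.exists_lift (fun m ν y => Schur.compGen μ (Function.update a i ⟨m, ν, y⟩)) ?_ ?_ ?_
  · intro m ν₁ ν₂ y
    obtain ⟨k, ν, x, rfl, h⟩ := hrep m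
    simp only [hupd k ν x h, MultilinearMap.map_update_add, Schur.mk_add]
  · intro m ν' y j v w
    obtain ⟨k, ν, x, rfl, h⟩ := hrep m
    have : ∀ z : V, flatten (Function.update x i (Function.update y j z)) =
        Function.update (flatten (Function.update x i y)) (finSigmaFinEquiv ⟨i, j⟩) z := by
      intro z
      funext t
      obtain ⟨⟨i', j'⟩, rfl⟩ := finSigmaFinEquiv.surjective t
      by_cases hi : i' = i
      · subst hi
        by_cases hj : j' = j
        · subst hj; simp [flatten_apply]
        · simp [hj, flatten_apply]
      · simp [hi, flatten_apply]
    simp only [hupd k ν x h, this, Schur.mk_update_add]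
  · intro m σ ν' y
    obtain ⟨k, ν, x, rfl, h⟩ := hrep m
    simp only [hupd k ν x h]
    have : Function.update ν i (P.relabel σ ν') = fun j => P.relabel
        (Function.update (fun j => Equiv.refl (Fin (k j))) i σ j) (Function.update ν i ν' j) := by
      funext j
      by_cases hj : j = i
      · subst hj; simp
      · simp [hj, P.relabel_refl]
    rw [this, P.comp_relabel, Schur.mk_relabel]
    congr 1
    funext t
    obtain ⟨⟨i', j'⟩, rfl⟩ := finSigmaFinEquiv.surjective t
    by_cases hi : i' = i
    · subst hi; simp [blockSum, flatten_apply]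
    · simp [hi, blockSum, flatten_apply]

/-- The action of the operation `μ` on `S(P, V)`: the unique multilinear map such that
`μ((ν₁; x₁), …, (νₙ; xₙ)) = (μ(ν₁, …, νₙ); x₁, …, xₙ)`. -/
def Schur.actMap {n : ℕ} (μ : P.obj n) :
    MultilinearMap F2 (fun _ : Fin n => Schur P V) (Schur P V) :=
  (Schur.exists_act μ).choose

theorem Schur.actMap_gen {n : ℕ} (μ : P.obj n)
    (a : Fin n → (m : ℕ) × P.obj m × (Fin m → V)) :
    Schur.actMap μ (fun i => Schur.gen (a i)) = Schur.compGen μ a :=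
  (Schur.exists_act μ).choose_spec a

theorem Schur.actMap_mk {n : ℕ} (μ : P.obj n) (k : Fin n → ℕ) (ν : ∀ i, P.obj (k i))
    (x : ∀ i, Fin (k i) → V) :
    Schur.actMap μ (fun i => Schur.mk (ν i) (x i)) =
      Schur.mk (P.comp k μ ν) (flatten x) :=
  Schur.actMap_gen μ (fun i => ⟨k i, ν i, x i⟩)

theorem Schur.multilinear_ext {n : ℕ} {Z : Type w} [AddCommGroup Z] [Module F2 Z]
    {f g : MultilinearMap F2 (fun _ : Fin n => Schur P V) Z}
    (h : ∀ (k : Fin n → ℕ) (ν : ∀ i, P.obj (k i)) (x : ∀ i, Fin (k i) → V),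
      f (fun i => Schur.mk (ν i) (x i)) = g (fun i => Schur.mk (ν i) (x i))) : f = g :=
  multilinear_ext_of_span (fun _ => Schur.gen) (fun _ => Schur.span_gen)
    (fun a => h (fun i => (a i).1) (fun i => (a i).2.1) (fun i => (a i).2.2))

theorem Schur.actMap_add {n : ℕ} (μ ν : P.obj n) :
    Schur.actMap (V := V) (μ + ν) = Schur.actMap μ + Schur.actMap ν := by
  refine Schur.multilinear_ext (fun k ξ x => ?_)
  simp only [Schur.actMap_mk, add_apply, map_add, Schur.mk_add]

variable (P V)

/-- The free `P`-algebra structure on `S(P, V)`. -/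
def Schur.algebra : PAlgebra P (Schur P V) where
  act :=
    { toFun := Schur.actMap
      map_add' := Schur.actMap_add
      map_smul' := map_smul_of_add _ Schur.actMap_add }
  act_relabel {m n} e μ x := by
    have : Schur.actMap (V := V) (P.relabel e μ) = (Schur.actMap μ).domDomCongr e := by
      refine Schur.multilinear_ext (fun k ν x => ?_)
      rw [MultilinearMap.domDomCongr_apply, Schur.actMap_mk,
        Schur.actMap_mk μ (fun i => k (e i)) (fun i => ν (e i)) (fun i => x (e i)),
        P.relabel_comp, Schur.mk_relabel]
      congr 1
      funext t
      obtain ⟨⟨i, j⟩, rfl⟩ := finSigmaFinEquiv.surjective t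
      rw [flatten_apply]
      simp only [blockPerm, Equiv.trans_apply, Equiv.symm_apply_apply, flatten_apply]
      rfl
    exact congrArg (fun F => F x) this
  act_one x := by
    have : Schur.actMap (V := V) P.one =
        MultilinearMap.ofSubsingleton F2 (Schur P V) (Schur P V) (0 : Fin 1) LinearMap.id := by
      refine Schur.multilinear_ext (fun k ν x => ?_)
      obtain ⟨m, rfl⟩ : ∃ m : ℕ, k = fun _ => m := ⟨k 0, by funext i; rw [Subsingleton.elim i 0]⟩
      obtain ⟨ν', rfl⟩ : ∃ ν', ν = fun _ => ν' := ⟨ν 0, by funext i; rw [Subsingleton.elim i 0]⟩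
      obtain ⟨x', rfl⟩ : ∃ x', x = fun _ => x' := ⟨x 0, by funext i; rw [Subsingleton.elim i 0]⟩
      rw [Schur.actMap_mk, P.one_comp, Schur.mk_relabel]
      simp [oneBlock, flatten_apply]
    exact congrArg (fun F => F x) this
  act_comp {n} k μ ν y := by
    have : Schur.actMap (V := V) (P.comp k μ ν) =
        ((Schur.actMap μ).compMultilinearMap (fun i => Schur.actMap (ν i))).domDomCongr
          finSigmaFinEquiv := by
      refine multilinear_ext_of_span (fun _ => Schur.gen) (fun _ => Schur.span_gen) (fun a => ?_)
      obtain ⟨b, rfl⟩ : ∃ b : ∀ i, Fin (k i) → (m : ℕ) × P.obj m × (Fin m → V),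
          a = flatten b := ⟨fun i j => a (finSigmaFinEquiv ⟨i, j⟩), by
            funext t
            obtain ⟨p, rfl⟩ := finSigmaFinEquiv.surjective t
            rw [flatten_apply]⟩
      rw [Schur.actMap_gen, MultilinearMap.domDomCongr_apply,
        MultilinearMap.compMultilinearMap_apply]
      have h1 : ∀ i, Schur.actMap (ν i) (Sigma.curry (γ := fun _ _ => Schur P V)
          (fun p => Schur.gen (flatten b (finSigmaFinEquiv p))) i) =
          Schur.mk (P.comp (fun j => (b i j).1) (ν i) (fun j => (b i j).2.1))
            (flatten fun j => (b i j).2.2) := by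
        intro i
        rw [← Schur.compGen, ← Schur.actMap_gen]
        congr 1
        funext j
        simp [Sigma.curry, flatten_apply]
      simp only [h1]
      rw [Schur.actMap_mk, ← P.comp_comp, Schur.mk_relabel]
      unfold Schur.compGen
      refine congrArg (Schur.mk _) ?_
      funext t
      obtain ⟨⟨t, j⟩, rfl⟩ := finSigmaFinEquiv.surjective t
      rw [flatten_apply]
      have h2 := blockAssoc_apply k (fun i j => (b i j).1) t j
      refine Eq.trans ?_ (congrArg (flatten fun i => flatten fun j => (b i j).2.2) h2).symm
      rw [flatten_apply, flatten_apply]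
      rfl
    exact congrArg (fun F => F y) this

end Schur

/-! ### Graded vector spaces -/

/-- An `ℕ`-graded `F2`-vector space, as the direct sum of its homogeneous parts. -/
structure GradedSpace where
  carrier : Type v
  [addCommGroup : AddCommGroup carrier]
  [module : Module F2 carrier]
  deg : ℕ → Submodule F2 carrier
  isInternal : DirectSum.IsInternal deg

attribute [instance] GradedSpace.addCommGroup GradedSpace.module

/-- A family of projections onto the members of a family of subspaces that span. -/
structure IsProjFamily {W : Type v} [AddCommGroup W] [Module F2 W] (deg : ℕ → Submodule F2 W)
    (π : ℕ → W →ₗ[F2] W) : Prop where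
  self : ∀ d x, x ∈ deg d → π d x = x
  ne : ∀ d e x, d ≠ e → x ∈ deg d → π e x = 0
  sup : ⨆ d, deg d = ⊤

theorem IsProjFamily.isInternal {W : Type v} [AddCommGroup W] [Module F2 W]
    {deg : ℕ → Submodule F2 W} {π : ℕ → W →ₗ[F2] W} (h : IsProjFamily deg π) :
    DirectSum.IsInternal deg := by
  rw [DirectSum.isInternal_submodule_iff_iSupIndep_and_iSup_eq_top]
  refine ⟨fun d => ?_, h.sup⟩
  rw [Submodule.disjoint_def]
  intro x hx hx'
  rw [← h.self d x hx, ← LinearMap.mem_ker]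
  refine (iSup₂_le (fun e he => ?_) : (⨆ e, ⨆ _ : e ≠ d, deg e) ≤ LinearMap.ker (π d)) hx'
  exact fun y hy => h.ne e d y he hy

namespace GradedSpace

/-- A graded space is the direct sum of its homogeneous parts. -/
def equiv (V : GradedSpace.{v}) : DirectSum ℕ (fun d => V.deg d) ≃ₗ[F2] V.carrier :=
  LinearEquiv.ofBijective (DirectSum.coeLinearMap V.deg) (by exact V.isInternal)

/-- The projection onto the homogeneous component of degree `d`. -/
def proj (V : GradedSpace.{v}) (d : ℕ) : V.carrier →ₗ[F2] V.carrier :=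
  (V.deg d).subtype ∘ₗ DirectSum.component F2 ℕ (fun d => V.deg d) d ∘ₗ
    V.equiv.symm.toLinearMap

theorem isProjFamily (V : GradedSpace.{v}) : IsProjFamily V.deg V.proj := by
  have key : ∀ d (x : V.carrier) (hx : x ∈ V.deg d), V.equiv.symm x =
      DirectSum.lof F2 ℕ (fun d => V.deg d) d ⟨x, hx⟩ := by
    intro d x hx
    rw [LinearEquiv.symm_apply_eq]
    exact (DirectSum.coeLinearMap_lof V.deg d ⟨x, hx⟩).symm
  refine ⟨fun d x hx => ?_, fun d e x hde hx => ?_, V.isInternal.submodule_iSup_eq_top⟩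
  · simp [proj, key d x hx, DirectSum.component.lof_self]
  · simp [proj, key d x hx, DirectSum.component.of, hde]

theorem linear_ext (V : GradedSpace.{v}) {Z : Type w} [AddCommGroup Z] [Module F2 Z]
    {f g : V.carrier →ₗ[F2] Z} (h : ∀ d x, x ∈ V.deg d → f x = g x) : f = g := by
  ext x
  have : (⨆ d, V.deg d) ≤ LinearMap.eqLocus f g := iSup_le (fun d x hx => h d x hx)
  exact this (by rw [V.isProjFamily.sup]; trivial)

theorem map_proj {V : GradedSpace.{v}} {W : GradedSpace.{w}} (f : V.carrier →ₗ[F2] W.carrier)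
    (hf : ∀ d x, x ∈ V.deg d → f x ∈ W.deg d) (d : ℕ) (x : V.carrier) :
    f (V.proj d x) = W.proj d (f x) := by
  have : f ∘ₗ V.proj d = W.proj d ∘ₗ f := by
    refine V.linear_ext (fun e x hx => ?_)
    by_cases hde : e = d
    · subst hde
      simp [V.isProjFamily.self e x hx, W.isProjFamily.self e _ (hf e x hx)]
    · simp [V.isProjFamily.ne e d x hde hx, W.isProjFamily.ne e d _ hde (hf e x hx)]
  exact LinearMap.congr_fun this x

/-- A subspace is homogeneous if it contains the homogeneous components of its elements. -/
def IsHomogeneous (V : GradedSpace.{v}) (N : Submodule F2 V.carrier) : Prop :=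
  ∀ d x, x ∈ N → V.proj d x ∈ N

theorem isProjFamily_quotient (V : GradedSpace.{v}) (N : Submodule F2 V.carrier)
    (h : V.IsHomogeneous N) :
    IsProjFamily (fun d => (V.deg d).map N.mkQ) (fun d => N.mapQ N (V.proj d) (h d)) := by
  refine ⟨?_, ?_, ?_⟩
  · rintro d _ ⟨x, hx, rfl⟩
    simp [V.isProjFamily.self d x hx]
  · rintro d e _ hde ⟨x, hx, rfl⟩
    simp [V.isProjFamily.ne d e x hde hx]
  · rw [← Submodule.map_iSup, V.isProjFamily.sup, Submodule.map_top, Submodule.range_mkQ]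

end GradedSpace

/-! ### The Steenrod algebra and unstable modules -/

/-- The relations of the mod 2 Steenrod algebra on the generators `Sq^i`: `Sq^0 = 1` and the Adem
relations. -/
inductive SteenrodRel : FreeAlgebra F2 ℕ → FreeAlgebra F2 ℕ → Prop
  | sq_zero : SteenrodRel (FreeAlgebra.ι F2 0) 1
  | adem (i j : ℕ) (hi : 0 < i) (hij : i < 2 * j) :
      SteenrodRel (FreeAlgebra.ι F2 i * FreeAlgebra.ι F2 j)
        (∑ k ∈ Finset.range (i / 2 + 1), ((Nat.choose (j - k - 1) (i - 2 * k) : ℕ) : F2) •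
          (FreeAlgebra.ι F2 (i + j - k) * FreeAlgebra.ι F2 k))

/-- The mod 2 Steenrod algebra. -/
abbrev Steenrod : Type := RingQuot SteenrodRel

/-- The Steenrod square `Sq^i`. -/
def Sq (i : ℕ) : Steenrod := RingQuot.mkAlgHom F2 SteenrodRel (FreeAlgebra.ι F2 i)

theorem Sq_zero : Sq 0 = 1 := by
  rw [Sq, RingQuot.mkAlgHom_rel F2 SteenrodRel.sq_zero, map_one]

theorem Sq_adem (i j : ℕ) (hi : 0 < i) (hij : i < 2 * j) :
    Sq i * Sq j = ∑ k ∈ Finset.range (i / 2 + 1),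
      ((Nat.choose (j - k - 1) (i - 2 * k) : ℕ) : F2) • (Sq (i + j - k) * Sq k) := by
  have := RingQuot.mkAlgHom_rel F2 (SteenrodRel.adem i j hi hij)
  simp only [map_mul, map_sum, map_smul] at this
  exact this

/-- Every element of the Steenrod algebra is a polynomial in the squares. -/
theorem Steenrod.induction {C : Steenrod → Prop} (scalar : ∀ r : F2, C (algebraMap F2 Steenrod r))
    (sq : ∀ i, C (Sq i)) (mul : ∀ a b, C a → C b → C (a * b)) (add : ∀ a b, C a → C b → C (a + b))
    (a : Steenrod) : C a := by
  obtain ⟨a, rfl⟩ := RingQuot.mkAlgHom_surjective F2 SteenrodRel a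
  induction a using FreeAlgebra.induction with
  | grade0 r => simpa using scalar r
  | grade1 i => exact sq i
  | mul a b ha hb => rw [map_mul]; exact mul _ _ ha hb
  | add a b ha hb => rw [map_add]; exact add _ _ ha hb

/-- An unstable module over the Steenrod algebra: a graded module `M` such that `Sq^i x = 0`
whenever `i > |x|`. -/
structure UnstableModule extends GradedSpace.{v} where
  act : Steenrod →ₐ[F2] Module.End F2 carrier
  sq_mem : ∀ i d x, x ∈ deg d → act (Sq i) x ∈ deg (d + i)
  unstable : ∀ i d x, x ∈ deg d → d < i → act (Sq i) x = 0

namespace UnstableModule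

/-- The operation `Sq^i` on `M`. -/
def sq (M : UnstableModule.{v}) (i : ℕ) : M.carrier →ₗ[F2] M.carrier := M.act (Sq i)

/-- `M` is connected if `M⁰ = 0`. -/
def IsConnected (M : UnstableModule.{v}) : Prop := M.deg 0 = ⊥

/-- `M` is reduced if `Sq₀ : x ↦ Sq^{|x|} x` is injective. -/
def IsReduced (M : UnstableModule.{v}) : Prop :=
  ∀ d x, x ∈ M.deg d → M.sq d x = 0 → x = 0

/-- A morphism of unstable modules. -/
structure Hom (M : UnstableModule.{v}) (N : UnstableModule.{w}) where
  toLinearMap : M.carrier →ₗ[F2] N.carrier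
  map_act : ∀ (a : Steenrod) (x : M.carrier), toLinearMap (M.act a x) = N.act a (toLinearMap x)
  map_deg : ∀ d x, x ∈ M.deg d → toLinearMap x ∈ N.deg d

/-- The suspension `ΣM`, with `(ΣM)^{d+1} = M^d` and `Sq^i (σ x) = σ (Sq^i x)`. -/
def susp (M : UnstableModule.{v}) : UnstableModule.{v} where
  carrier := M.carrier
  deg d := Nat.casesOn d ⊥ M.deg
  isInternal := by
    refine IsProjFamily.isInternal (π := fun d => Nat.casesOn d 0 M.proj) ⟨?_, ?_, ?_⟩
    · rintro (_ | d) x hx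
      · simpa using hx.symm
      · exact M.isProjFamily.self d x hx
    · rintro (_ | d) (_ | e) x hde hx
      · rfl
      · have hx0 : x = 0 := hx
        simp [hx0]
      · rfl
      · exact M.isProjFamily.ne d e x (by simpa using hde) hx
    · rw [eq_top_iff, ← M.isProjFamily.sup]
      exact iSup_le (fun d => le_iSup (fun d : ℕ =>
        (Nat.casesOn d ⊥ M.deg : Submodule F2 M.carrier)) (d + 1))
  act := M.act
  sq_mem := by
    rintro i (_ | d) x hx
    · have hx0 : x = 0 := hx
      rw [hx0, map_zero]
      exact Submodule.zero_mem _
    · rw [Nat.add_right_comm]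
      exact M.sq_mem i d x hx
  unstable := by
    rintro i (_ | d) x hx hi
    · have hx0 : x = 0 := hx
      rw [hx0, map_zero]
    · exact M.unstable i d x hx (by omega)

/-- The image of `Sq₀`. -/
def imSq0 (M : UnstableModule.{v}) : Submodule F2 M.carrier := ⨆ d, (M.deg d).map (M.sq d)

theorem sq_mem_imSq0 (M : UnstableModule.{v}) {d : ℕ} {x : M.carrier} (hx : x ∈ M.deg d) :
    M.sq d x ∈ M.imSq0 :=
  (le_iSup (fun d => (M.deg d).map (M.sq d)) d) ⟨x, hx, rfl⟩

theorem imSq0_isHomogeneous (M : UnstableModule.{v}) : M.IsHomogeneous M.imSq0 := by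
  intro e
  refine (iSup_le fun d => ?_ : M.imSq0 ≤ M.imSq0.comap (M.proj e))
  rintro _ ⟨x, hx, rfl⟩
  rw [Submodule.mem_comap]
  have hd : M.sq d x ∈ M.deg (d + d) := M.sq_mem d d x hx
  by_cases h : d + d = e
  · subst h
    rw [M.isProjFamily.self _ _ hd]
    exact M.sq_mem_imSq0 hx
  · rw [M.isProjFamily.ne _ _ _ h hd]
    exact Submodule.zero_mem _

theorem sq_sq0 (M : UnstableModule.{v}) (i d : ℕ) (x : M.carrier) (hx : x ∈ M.deg d) :
    M.sq i (M.sq d x) ∈ M.imSq0 := by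
  have hd : M.sq d x ∈ M.deg (d + d) := M.sq_mem d d x hx
  rcases Nat.eq_zero_or_pos i with rfl | hi
  · rw [sq, Sq_zero, map_one]
    exact M.sq_mem_imSq0 hx
  rcases lt_trichotomy i (d + d) with h | h | h
  · have h1 : M.sq i (M.sq d x) = M.act (Sq i * Sq d) x := by rw [map_mul]; rfl
    rw [h1, Sq_adem i d hi (by omega), map_sum, LinearMap.sum_apply]
    refine Submodule.sum_mem _ (fun k hk => ?_)
    rw [map_smul, map_mul]
    refine Submodule.smul_mem _ _ ?_
    change M.sq (i + d - k) (M.sq k x) ∈ M.imSq0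
    have hkx : M.sq k x ∈ M.deg (d + k) := M.sq_mem k d x hx
    rw [Finset.mem_range] at hk
    by_cases h2 : i + d - k = d + k
    · rw [h2]; exact M.sq_mem_imSq0 hkx
    · have : M.sq (i + d - k) (M.sq k x) = 0 := M.unstable _ _ _ hkx (by omega)
      rw [this]
      exact Submodule.zero_mem _
  · subst h; exact M.sq_mem_imSq0 hd
  · have : M.sq i (M.sq d x) = 0 := M.unstable _ _ _ hd h
    rw [this]
    exact Submodule.zero_mem _

theorem imSq0_act (M : UnstableModule.{v}) (a : Steenrod) :
    M.imSq0 ≤ M.imSq0.comap (M.act a) := by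
  induction a using Steenrod.induction with
  | scalar r =>
    intro x hx
    rw [Submodule.mem_comap, AlgHom.commutes]
    exact Submodule.smul_mem _ r hx
  | sq i =>
    refine iSup_le (fun d => ?_)
    rintro _ ⟨x, hx, rfl⟩
    exact M.sq_sq0 i d x hx
  | mul a b ha hb =>
    intro x hx
    rw [Submodule.mem_comap, map_mul]
    exact ha (hb hx)
  | add a b ha hb =>
    intro x hx
    rw [Submodule.mem_comap, map_add]
    exact Submodule.add_mem _ (ha hx) (hb hx)

/-- The module `ΩM = Σ⁻¹(M / Im Sq₀)`. -/
def omega (M : UnstableModule.{v}) : UnstableModule.{v} where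
  carrier := M.carrier ⧸ M.imSq0
  deg d := (M.deg (d + 1)).map M.imSq0.mkQ
  isInternal := by
    have h := M.isProjFamily_quotient M.imSq0 M.imSq0_isHomogeneous
    refine IsProjFamily.isInternal
      (π := fun d => M.imSq0.mapQ M.imSq0 (M.proj (d + 1)) (M.imSq0_isHomogeneous (d + 1)))
      ⟨fun d => h.self (d + 1), fun d e x hde => h.ne (d + 1) (e + 1) x (by simpa using hde), ?_⟩
    rw [eq_top_iff, ← h.sup]
    refine iSup_le fun d => ?_
    cases d with
    | zero =>
      rintro _ ⟨x, hx, rfl⟩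
      have h0 := M.sq_mem_imSq0 hx
      rw [sq, Sq_zero, map_one] at h0
      have : M.imSq0.mkQ x = 0 := by simpa using h0
      rw [this]
      exact Submodule.zero_mem _
    | succ d => exact le_iSup (fun d => (M.deg (d + 1)).map M.imSq0.mkQ) d
  act :=
    { toFun := fun a => M.imSq0.mapQ M.imSq0 (M.act a) (M.imSq0_act a)
      map_one' := by ext x; simp
      map_mul' := fun a b => by ext x; simp
      map_zero' := by ext x; simp
      map_add' := fun a b => by ext x; simp
      commutes' := fun r => by ext x; simp }
  sq_mem := by
    rintro i d _ ⟨x, hx, rfl⟩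
    rw [Nat.add_right_comm]
    exact ⟨_, M.sq_mem i (d + 1) x hx, rfl⟩
  unstable := by
    rintro i d _ ⟨x, hx, rfl⟩ hi
    have key : M.sq i x ∈ M.imSq0 := by
      rcases Nat.eq_or_lt_of_le (Nat.succ_le_of_lt hi) with h | h
      · subst h; exact M.sq_mem_imSq0 hx
      · have : M.sq i x = 0 := M.unstable _ _ _ hx h
        rw [this]
        exact Submodule.zero_mem _
    exact (Submodule.Quotient.mk_eq_zero _).2 key

/-- The functor `Σ` on morphisms. -/
def Hom.susp {M : UnstableModule.{v}} {N : UnstableModule.{w}} (f : M.Hom N) :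
    M.susp.Hom N.susp where
  toLinearMap := f.toLinearMap
  map_act := f.map_act
  map_deg := by
    rintro (_ | d) x hx
    · have hx0 : x = 0 := hx
      exact hx0 ▸ f.toLinearMap.map_zero
    · exact f.map_deg d x hx

theorem Hom.imSq0_le {M : UnstableModule.{v}} {N : UnstableModule.{w}} (f : M.Hom N) :
    M.imSq0 ≤ N.imSq0.comap f.toLinearMap := by
  refine iSup_le (fun d => ?_)
  rintro _ ⟨x, hx, rfl⟩
  rw [Submodule.mem_comap, UnstableModule.sq, f.map_act]
  exact N.sq_mem_imSq0 (f.map_deg d x hx)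

/-- The functor `Ω` on morphisms. -/
def Hom.omega {M : UnstableModule.{v}} {N : UnstableModule.{w}} (f : M.Hom N) :
    M.omega.Hom N.omega where
  toLinearMap := M.imSq0.mapQ N.imSq0 f.toLinearMap f.imSq0_le
  map_act a x := by
    obtain ⟨x, rfl⟩ := Submodule.mkQ_surjective _ x
    exact congrArg N.imSq0.mkQ (f.map_act a x)
  map_deg := by
    rintro d _ ⟨x, hx, rfl⟩
    exact ⟨_, f.map_deg _ x hx, rfl⟩

/-- The projection `pr : M → ΣΩM`. -/
def pr (M : UnstableModule.{v}) : M.carrier →ₗ[F2] M.omega.susp.carrier := M.imSq0.mkQ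

/-- A graded section of `pr : M → ΣΩM`; it need not commute with the Steenrod operations. -/
structure GradedSection (M : UnstableModule.{v}) where
  toLinearMap : M.omega.susp.carrier →ₗ[F2] M.carrier
  map_deg : ∀ d b, b ∈ M.omega.susp.deg d → toLinearMap b ∈ M.deg d
  pr_apply : ∀ b, M.pr (toLinearMap b) = b

end UnstableModule

/-! ### Graded algebras over an operad -/

/-- A graded `P`-algebra, the operad `P` being concentrated in degree zero. -/
structure GradedPAlgebra (P : Operad.{u}) extends GradedSpace.{v} where
  alg : PAlgebra P carrier
  act_mem : ∀ {n : ℕ} (μ : P.obj n) (a : Fin n → ℕ) (x : Fin n → carrier),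
    (∀ i, x i ∈ deg (a i)) → alg.act μ x ∈ deg (∑ i, a i)

namespace GradedPAlgebra

variable {P : Operad.{u}}

/-- An isomorphism of graded `P`-algebras. -/
structure Iso (A : GradedPAlgebra.{u, v} P) (B : GradedPAlgebra.{u, w} P) where
  toLinearEquiv : A.carrier ≃ₗ[F2] B.carrier
  map_act : ∀ {n : ℕ} (μ : P.obj n) (x : Fin n → A.carrier),
    toLinearEquiv (A.alg.act μ x) = B.alg.act μ (fun i => toLinearEquiv (x i))
  map_deg : ∀ d x, x ∈ A.deg d ↔ toLinearEquiv x ∈ B.deg d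

/-- A `P`-ideal: a subspace `I` such that `μ(x₁, …, xₙ)` lies in `I` as soon as some `xᵢ` does. -/
def IsIdeal (A : GradedPAlgebra.{u, v} P) (I : Submodule F2 A.carrier) : Prop :=
  ∀ {n : ℕ} (μ : P.obj n) (x : Fin n → A.carrier) (i : Fin n), x i ∈ I → A.alg.act μ x ∈ I

theorem exists_quotient_act (A : GradedPAlgebra.{u, v} P) (I : Submodule F2 A.carrier)
    (hI : A.IsIdeal I) {n : ℕ} (μ : P.obj n) :
    ∃ F : MultilinearMap F2 (fun _ : Fin n => A.carrier ⧸ I) (A.carrier ⧸ I),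
      ∀ x : Fin n → A.carrier, F (fun i => I.mkQ (x i)) = I.mkQ (A.alg.act μ x) := by
  refine exists_multilinear (W := fun _ : Fin n => A.carrier ⧸ I) (fun _ => I.mkQ)
    (fun _ => ?_) (fun x => I.mkQ (A.alg.act μ x)) (fun i x => ?_)
  · rw [Set.range_eq_univ.2 I.mkQ_surjective, Submodule.span_univ]
  · refine ⟨I.liftQ (I.mkQ ∘ₗ (A.alg.act μ).toLinearMap x i) (fun y hy => ?_), fun y => rfl⟩
    rw [LinearMap.mem_ker, LinearMap.comp_apply, Submodule.mkQ_apply, Submodule.Quotient.mk_eq_zero]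
    exact hI μ _ i (by simpa using hy)

/-- The operation induced by `μ` on the quotient by an ideal. -/
def quotientAct (A : GradedPAlgebra.{u, v} P) (I : Submodule F2 A.carrier)
    (hI : A.IsIdeal I) {n : ℕ} (μ : P.obj n) :
    MultilinearMap F2 (fun _ : Fin n => A.carrier ⧸ I) (A.carrier ⧸ I) :=
  (A.exists_quotient_act I hI μ).choose

theorem quotientAct_mk (A : GradedPAlgebra.{u, v} P) (I : Submodule F2 A.carrier)
    (hI : A.IsIdeal I) {n : ℕ} (μ : P.obj n) (x : Fin n → A.carrier) :
    A.quotientAct I hI μ (fun i => I.mkQ (x i)) = I.mkQ (A.alg.act μ x) :=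
  (A.exists_quotient_act I hI μ).choose_spec x

theorem exists_mk {ι : Type*} {W : Type v} [AddCommGroup W] [Module F2 W] (I : Submodule F2 W)
    (x : ι → W ⧸ I) : ∃ y : ι → W, x = fun i => I.mkQ (y i) := by
  choose y hy using fun i => I.mkQ_surjective (x i)
  exact ⟨y, funext fun i => (hy i).symm⟩

theorem quotientAct_add (A : GradedPAlgebra.{u, v} P) (I : Submodule F2 A.carrier)
    (hI : A.IsIdeal I) {n : ℕ} (μ ν : P.obj n) :
    A.quotientAct I hI (μ + ν) = A.quotientAct I hI μ + A.quotientAct I hI ν := by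
  refine MultilinearMap.ext fun x => ?_
  obtain ⟨y, rfl⟩ := exists_mk I x
  simp only [quotientAct_mk, add_apply, map_add]

/-- The quotient of a graded `P`-algebra by a homogeneous ideal. -/
def quotient (A : GradedPAlgebra.{u, v} P) (I : Submodule F2 A.carrier) (hI : A.IsIdeal I)
    (hI' : A.IsHomogeneous I) : GradedPAlgebra.{u, v} P where
  carrier := A.carrier ⧸ I
  deg d := (A.deg d).map I.mkQ
  isInternal := (A.isProjFamily_quotient I hI').isInternal
  alg :=
    { act :=
        { toFun := A.quotientAct I hI
          map_add' := A.quotientAct_add I hI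
          map_smul' := map_smul_of_add _ (A.quotientAct_add I hI) }
      act_relabel := fun e μ x => by
        obtain ⟨y, rfl⟩ := exists_mk I x
        simp only [LinearMap.coe_mk, AddHom.coe_mk]
        rw [quotientAct_mk, A.alg.act_relabel, ← quotientAct_mk A I hI]
      act_one := fun x => by
        obtain ⟨y, rfl⟩ := exists_mk I x
        simp only [LinearMap.coe_mk, AddHom.coe_mk]
        rw [quotientAct_mk, A.alg.act_one]
      act_comp := fun k μ ν x => by
        obtain ⟨y, rfl⟩ := exists_mk I x
        simp only [LinearMap.coe_mk, AddHom.coe_mk]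
        rw [quotientAct_mk, A.alg.act_comp, ← quotientAct_mk A I hI]
        simp only [← quotientAct_mk A I hI] }
  act_mem := fun μ a x hx => by
    choose y hy hyx using hx
    obtain rfl : (fun i => I.mkQ (y i)) = x := funext hyx
    exact ⟨_, A.act_mem μ a y hy, (quotientAct_mk A I hI μ y).symm⟩

end GradedPAlgebra

/-! ### The free graded algebra -/

section Free

variable (P : Operad.{u})

theorem Schur.exists_cartan {V : Type v} [AddCommGroup V] [Module F2 V] (T : ℕ → V →ₗ[F2] V)
    (d : ℕ) : ∃ L : Schur P V →ₗ[F2] Schur P V, ∀ n (μ : P.obj n) (x : Fin n → V),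
      L (Schur.mk μ x) =
        ∑ a ∈ Finset.Nat.antidiagonalTuple n d, Schur.mk μ (fun i => T (a i) (x i)) := by
  refine Schur.exists_lift
    (fun n μ x => ∑ a ∈ Finset.Nat.antidiagonalTuple n d, Schur.mk μ (fun i => T (a i) (x i)))
    ?_ ?_ ?_
  · intro n μ ν x
    simp only [Schur.mk_add, Finset.sum_add_distrib]
  · intro n μ x i v w
    have h : ∀ (a : Fin n → ℕ) (z : V), (fun j => T (a j) (Function.update x i z j)) =
        Function.update (fun j => T (a j) (x j)) i (T (a i) z) := by
      intro a z
      funext j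
      by_cases hj : j = i
      · subst hj; simp
      · simp [hj]
    simp only [h, map_add, Schur.mk_update_add, Finset.sum_add_distrib]
  · intro n σ μ x
    simp only [Schur.mk_relabel]
    refine Finset.sum_equiv (Equiv.arrowCongr σ.symm (Equiv.refl ℕ)) (fun a => ?_) (fun a _ => ?_)
    · simp only [Finset.Nat.mem_antidiagonalTuple, Equiv.arrowCongr_apply, Equiv.coe_refl,
        Function.comp_apply, id_eq, Equiv.symm_symm]
      rw [Equiv.sum_comp σ a]
    · rfl

/-- The Cartan extension to `S(P, V)` of a sequence of operators `T^i` on `V`: the linear map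
`(μ; x₁, …, xₙ) ↦ ∑_{i₁ + ⋯ + iₙ = d} (μ; T^{i₁} x₁, …, T^{iₙ} xₙ)`. -/
def Schur.cartan {V : Type v} [AddCommGroup V] [Module F2 V] (T : ℕ → V →ₗ[F2] V) (d : ℕ) :
    Schur P V →ₗ[F2] Schur P V :=
  (Schur.exists_cartan P T d).choose

theorem Schur.cartan_mk {V : Type v} [AddCommGroup V] [Module F2 V] (T : ℕ → V →ₗ[F2] V) (d : ℕ)
    {n : ℕ} (μ : P.obj n) (x : Fin n → V) : Schur.cartan P T d (Schur.mk μ x) =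
      ∑ a ∈ Finset.Nat.antidiagonalTuple n d, Schur.mk μ (fun i => T (a i) (x i)) :=
  (Schur.exists_cartan P T d).choose_spec n μ x

/-- Elements `(μ; x₁, …, xₙ)` with homogeneous `xᵢ` whose degrees add up to `d`. -/
def Schur.homGen (V : GradedSpace.{v}) (d : ℕ) : Set (Schur P V.carrier) :=
  {t | ∃ (n : ℕ) (μ : P.obj n) (a : Fin n → ℕ) (x : Fin n → V.carrier),
    (∀ i, x i ∈ V.deg (a i)) ∧ ∑ i, a i = d ∧ t = Schur.mk μ x}

/-- The homogeneous part of degree `d` of `S(P, V)`. -/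
def Schur.deg (V : GradedSpace.{v}) (d : ℕ) : Submodule F2 (Schur P V.carrier) :=
  Submodule.span F2 (Schur.homGen P V d)

theorem Schur.mk_mem_deg {V : GradedSpace.{v}} {n : ℕ} (μ : P.obj n) (a : Fin n → ℕ)
    (x : Fin n → V.carrier) (h : ∀ i, x i ∈ V.deg (a i)) :
    Schur.mk μ x ∈ Schur.deg P V (∑ i, a i) :=
  Submodule.subset_span ⟨n, μ, a, x, h, rfl, rfl⟩

theorem Schur.mk_zero_of {V : Type v} [AddCommGroup V] [Module F2 V] {n : ℕ} (μ : P.obj n)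
    (x : Fin n → V) (i : Fin n) (h : x i = 0) : Schur.mk μ x = 0 := by
  rw [Schur.mk, MultilinearMap.map_coord_zero _ i h, TensorProduct.tmul_zero, map_zero, map_zero]

theorem Schur.cartan_proj {V : GradedSpace.{v}} (d : ℕ) {n : ℕ} (μ : P.obj n) (a : Fin n → ℕ)
    (x : Fin n → V.carrier) (h : ∀ i, x i ∈ V.deg (a i)) :
    Schur.cartan P V.proj d (Schur.mk μ x) = if ∑ i, a i = d then Schur.mk μ x else 0 := by
  rw [Schur.cartan_mk]
  have h1 : ∀ b : Fin n → ℕ, b ≠ a → Schur.mk μ (fun i => V.proj (b i) (x i)) = 0 := by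
    intro b hb
    obtain ⟨i, hi⟩ := Function.ne_iff.1 hb
    exact Schur.mk_zero_of P μ _ i (V.isProjFamily.ne _ _ _ hi.symm (h i))
  split_ifs with hd
  · rw [Finset.sum_eq_single a (fun b _ hb => h1 b hb)
      (fun ha => absurd (Finset.Nat.mem_antidiagonalTuple.2 hd) ha)]
    congr 1
    funext i
    exact V.isProjFamily.self _ _ (h i)
  · refine Finset.sum_eq_zero fun b hb => h1 b ?_
    rintro rfl
    exact hd (Finset.Nat.mem_antidiagonalTuple.1 hb)

theorem Schur.isProjFamily (V : GradedSpace.{v}) :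
    IsProjFamily (Schur.deg P V) (Schur.cartan P V.proj) := by
  refine ⟨fun d x hx => ?_, fun d e x hde hx => ?_, ?_⟩
  · induction hx using Submodule.span_induction with
    | mem x hx =>
      obtain ⟨n, μ, a, x, h, hd, rfl⟩ := hx
      rw [Schur.cartan_proj P d μ a x h, if_pos hd]
    | zero => simp
    | add x y _ _ hx hy => rw [map_add, hx, hy]
    | smul c x _ hx => rw [map_smul, hx]
  · induction hx using Submodule.span_induction with
    | mem x hx =>
      obtain ⟨n, μ, a, x, h, hd, rfl⟩ := hx
      rw [Schur.cartan_proj P e μ a x h, if_neg (by rw [hd]; exact hde)]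
    | zero => simp
    | add x y _ _ hx hy => rw [map_add, hx, hy, add_zero]
    | smul c x _ hx => rw [map_smul, hx, smul_zero]
  · rw [eq_top_iff, ← Schur.span_gen, Submodule.span_le]
    rintro _ ⟨⟨n, μ, x⟩, rfl⟩
    let f : MultilinearMap F2 (fun _ : Fin n => V.carrier) (Schur P V.carrier) :=
      (Schur.incl P V.carrier n ∘ₗ (coinvRel P V.carrier n).mkQ ∘ₗ
        TensorProduct.mk F2 (P.obj n) _ μ).compMultilinearMap (PiTensorProduct.tprod F2)
    refine multilinear_mem_of_span f (fun _ => ⋃ d, (V.deg d : Set V.carrier)) _ ?_ x ?_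
    · intro y hy
      have hy' : ∀ i, ∃ d, y i ∈ V.deg d := fun i => by simpa using hy i
      choose a ha using hy'
      exact (le_iSup (Schur.deg P V) _) (Schur.mk_mem_deg P μ a y ha)
    · intro i
      rw [← Submodule.iSup_eq_span, V.isProjFamily.sup]
      trivial

/-- The free graded `P`-algebra `S(P, V)` on a graded vector space `V`. -/
def freeAlgebra (V : GradedSpace.{v}) : GradedPAlgebra.{u, max u v} P where
  carrier := Schur P V.carrier
  deg := Schur.deg P V
  isInternal := (Schur.isProjFamily P V).isInternal
  alg := Schur.algebra P V.carrier
  act_mem := fun {n} μ d t ht => by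
    refine multilinear_mem_of_span (Schur.actMap μ) (fun i => Schur.homGen P V (d i)) _ ?_ t ht
    intro s hs
    choose m ν a x hx hd hs using hs
    obtain rfl := funext hs
    rw [Schur.actMap_mk]
    have h := Schur.mk_mem_deg P (P.comp m μ ν) (flatten a) (flatten x) (fun t => hx _ _)
    have hsum : ∑ t, flatten a t = ∑ i, d i := by
      rw [← Equiv.sum_comp finSigmaFinEquiv, Fintype.sum_sigma]
      exact Finset.sum_congr rfl fun i _ => by simp only [flatten_apply, hd]
    rw [← hsum]
    exact h

/-- The inclusion of generators `V → S(P, V)`, `v ↦ (1; v)`. -/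
def freeAlgebra.unit (V : GradedSpace.{v}) (x : V.carrier) : (freeAlgebra P V).carrier :=
  Schur.mk P.one (fun _ => x)

theorem Schur.exists_map {V : Type v} [AddCommGroup V] [Module F2 V] {W : Type w} [AddCommGroup W]
    [Module F2 W] (f : V →ₗ[F2] W) : ∃ L : Schur P V →ₗ[F2] Schur P W,
      ∀ n (μ : P.obj n) (x : Fin n → V), L (Schur.mk μ x) = Schur.mk μ (fun i => f (x i)) := by
  refine Schur.exists_lift (fun n μ x => Schur.mk μ (fun i => f (x i)))
    (fun n μ ν x => Schur.mk_add _ _ _) (fun n μ x i v w => ?_)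
    (fun n σ μ x => Schur.mk_relabel _ _ _)
  have h : ∀ z : V, (fun j => f (Function.update x i z j)) =
      Function.update (fun j => f (x j)) i (f z) := by
    intro z
    funext j
    by_cases hj : j = i
    · subst hj; simp
    · simp [hj]
  simp only [h, map_add, Schur.mk_update_add]

/-- The map `S(P, f) : (μ; x₁, …, xₙ) ↦ (μ; f x₁, …, f xₙ)`. -/
def Schur.map {V : Type v} [AddCommGroup V] [Module F2 V] {W : Type w} [AddCommGroup W]
    [Module F2 W] (f : V →ₗ[F2] W) : Schur P V →ₗ[F2] Schur P W :=
  (Schur.exists_map P f).choose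

theorem Schur.map_mk {V : Type v} [AddCommGroup V] [Module F2 V] {W : Type w} [AddCommGroup W]
    [Module F2 W] (f : V →ₗ[F2] W) {n : ℕ} (μ : P.obj n) (x : Fin n → V) :
    Schur.map P f (Schur.mk μ x) = Schur.mk μ (fun i => f (x i)) :=
  (Schur.exists_map P f).choose_spec n μ x

theorem Schur.map_act {V : Type v} [AddCommGroup V] [Module F2 V] {W : Type w} [AddCommGroup W]
    [Module F2 W] (f : V →ₗ[F2] W) {n : ℕ} (μ : P.obj n) (t : Fin n → Schur P V) :
    Schur.map P f (Schur.actMap μ t) = Schur.actMap μ (fun i => Schur.map P f (t i)) := by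
  have : (Schur.map P f).compMultilinearMap (Schur.actMap μ) =
      (Schur.actMap μ).compLinearMap (fun _ => Schur.map P f) := by
    refine Schur.multilinear_ext (fun k ν x => ?_)
    simp only [LinearMap.compMultilinearMap_apply, MultilinearMap.compLinearMap_apply,
      Schur.actMap_mk, Schur.map_mk]
    rfl
  exact congrArg (fun F => F t) this

theorem Schur.map_deg {V : GradedSpace.{v}} {W : GradedSpace.{w}}
    (f : V.carrier →ₗ[F2] W.carrier) (hf : ∀ d x, x ∈ V.deg d → f x ∈ W.deg d) (d : ℕ)
    (t : Schur P V.carrier) (ht : t ∈ Schur.deg P V d) : Schur.map P f t ∈ Schur.deg P W d := by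
  refine (Submodule.span_le.2 ?_ : Schur.deg P V d ≤ (Schur.deg P W d).comap (Schur.map P f)) ht
  rintro _ ⟨n, μ, a, x, hx, rfl, rfl⟩
  rw [SetLike.mem_coe, Submodule.mem_comap, Schur.map_mk]
  exact Schur.mk_mem_deg P μ a _ (fun i => hf _ _ (hx i))

/-- The map `S(P, f)` of free graded algebras induced by a linear map `f`. -/
def freeAlgebra.map {V : GradedSpace.{v}} {W : GradedSpace.{w}} (f : V.carrier →ₗ[F2] W.carrier) :
    (freeAlgebra P V).carrier →ₗ[F2] (freeAlgebra P W).carrier :=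
  Schur.map P f

theorem Schur.map_cartan {V : Type v} [AddCommGroup V] [Module F2 V] {W : Type w} [AddCommGroup W]
    [Module F2 W] (f : V →ₗ[F2] W) (T : ℕ → V →ₗ[F2] V) (T' : ℕ → W →ₗ[F2] W)
    (h : ∀ i x, f (T i x) = T' i (f x)) (d : ℕ) (t : Schur P V) :
    Schur.map P f (Schur.cartan P T d t) = Schur.cartan P T' d (Schur.map P f t) := by
  have : Schur.map P f ∘ₗ Schur.cartan P T d = Schur.cartan P T' d ∘ₗ Schur.map P f := by
    refine Schur.linear_ext (fun n μ x => ?_)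
    simp only [LinearMap.comp_apply, Schur.cartan_mk, Schur.map_mk, map_sum, h]
  exact LinearMap.congr_fun this t

end Free

/-! ### The free unstable algebra -/

section FreeUnstable

variable (P : Operad.{u}) (star : P.obj 2)

/-- The operation `Sq^i` on `S(P, M)`, given by the Cartan formula. -/
def sqFree (M : UnstableModule.{v}) (i : ℕ) :
    (freeAlgebra P M.toGradedSpace).carrier →ₗ[F2] (freeAlgebra P M.toGradedSpace).carrier :=
  Schur.cartan P M.sq i

/-- A `P`-ideal of `S(P, M)` in the category of unstable modules: a `P`-ideal that is a graded
subspace and stable under the Steenrod operations. -/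
structure IsUnstableIdeal (M : UnstableModule.{v})
    (I : Submodule F2 (freeAlgebra P M.toGradedSpace).carrier) : Prop where
  isIdeal : (freeAlgebra P M.toGradedSpace).IsIdeal I
  isHomogeneous : (freeAlgebra P M.toGradedSpace).IsHomogeneous I
  sq_mem : ∀ i t, t ∈ I → sqFree P M i t ∈ I

/-- The elements `Sq₀ t + star(t, t)` for homogeneous `t` in `S(P, M)`. -/
def unstRel (M : UnstableModule.{v}) : Set (freeAlgebra P M.toGradedSpace).carrier :=
  {r | ∃ (d : ℕ) (t : (freeAlgebra P M.toGradedSpace).carrier),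
    t ∈ (freeAlgebra P M.toGradedSpace).deg d ∧
      r = sqFree P M d t + (freeAlgebra P M.toGradedSpace).alg.act star (fun _ => t)}

/-- The smallest `P`-ideal in unstable modules that contains all `Sq₀ t + star(t, t)`. -/
def unstIdeal (M : UnstableModule.{v}) : Submodule F2 (freeAlgebra P M.toGradedSpace).carrier :=
  sInf {I | IsUnstableIdeal P M I ∧ unstRel P star M ⊆ I}

theorem unstIdeal_isUnstableIdeal (M : UnstableModule.{v}) :
    IsUnstableIdeal P M (unstIdeal P star M) where
  isIdeal := fun μ x i hx => by
    rw [unstIdeal, Submodule.mem_sInf] at hx ⊢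
    exact fun I hI => hI.1.isIdeal μ x i (hx I hI)
  isHomogeneous := fun d x hx => by
    rw [unstIdeal, Submodule.mem_sInf] at hx ⊢
    exact fun I hI => hI.1.isHomogeneous d x (hx I hI)
  sq_mem := fun i t ht => by
    rw [unstIdeal, Submodule.mem_sInf] at ht ⊢
    exact fun I hI => hI.1.sq_mem i t (ht I hI)

/-- The graded `P`-algebra underlying the free `star`-unstable `P`-algebra on `M`, the quotient of
`S(P, M)` by the ideal in unstable modules generated by all `Sq₀ t + star(t, t)`. -/
def freeUnstable (M : UnstableModule.{v}) : GradedPAlgebra.{u, max u v} P :=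
  (freeAlgebra P M.toGradedSpace).quotient (unstIdeal P star M)
    (unstIdeal_isUnstableIdeal P star M).isIdeal
    (unstIdeal_isUnstableIdeal P star M).isHomogeneous

/-- The canonical map `M → K(M)`. -/
def freeUnstable.unit (M : UnstableModule.{v}) (x : M.carrier) : (freeUnstable P star M).carrier :=
  (unstIdeal P star M).mkQ (freeAlgebra.unit P M.toGradedSpace x)

variable {M : UnstableModule.{v}} {N : UnstableModule.{w}}

theorem unstIdeal_le (f : M.Hom N) :
    unstIdeal P star M ≤ (unstIdeal P star N).comap (freeAlgebra.map P f.toLinearMap) := by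
  have hN := unstIdeal_isUnstableIdeal P star N
  have hact : ∀ {n : ℕ} (μ : P.obj n) (t : Fin n → (freeAlgebra P M.toGradedSpace).carrier),
      freeAlgebra.map P f.toLinearMap ((freeAlgebra P M.toGradedSpace).alg.act μ t) =
        (freeAlgebra P N.toGradedSpace).alg.act μ
          (fun i => freeAlgebra.map P f.toLinearMap (t i)) :=
    fun μ t => Schur.map_act P f.toLinearMap μ t
  have hdeg : ∀ d t, t ∈ (freeAlgebra P M.toGradedSpace).deg d →
      freeAlgebra.map P f.toLinearMap t ∈ (freeAlgebra P N.toGradedSpace).deg d :=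
    Schur.map_deg P f.toLinearMap f.map_deg
  have hsq : ∀ i t, freeAlgebra.map P f.toLinearMap (sqFree P M i t) =
      sqFree P N i (freeAlgebra.map P f.toLinearMap t) :=
    Schur.map_cartan P f.toLinearMap M.sq N.sq (fun i => f.map_act (Sq i))
  refine sInf_le ⟨⟨fun μ x i hx => ?_, fun d x hx => ?_, fun i t ht => ?_⟩, ?_⟩
  · rw [Submodule.mem_comap] at hx ⊢
    rw [hact]
    exact hN.isIdeal μ _ i hx
  · rw [Submodule.mem_comap] at hx ⊢
    rw [GradedSpace.map_proj _ hdeg]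
    exact hN.isHomogeneous d _ hx
  · rw [Submodule.mem_comap] at ht ⊢
    rw [hsq]
    exact hN.sq_mem i _ ht
  · rintro _ ⟨d, t, ht, rfl⟩
    rw [SetLike.mem_coe, Submodule.mem_comap, map_add, hact, hsq, unstIdeal, Submodule.mem_sInf]
    exact fun I hI => hI.2 ⟨d, _, hdeg d t ht, rfl⟩

/-- The functor `K` on morphisms. -/
def freeUnstable.map (f : M.Hom N) : (freeUnstable P star M).carrier →ₗ[F2] (freeUnstable P star N).carrier :=
  (unstIdeal P star M).mapQ (unstIdeal P star N) (freeAlgebra.map P f.toLinearMap)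
    (unstIdeal_le P star f)

/-- The isomorphism `e : K(M) ≅ S(P, ΣΩM)` is induced by the graded section `s : ΣΩM → M`: its
inverse, a morphism of `P`-algebras, sends every generator `b` in `ΣΩM` to the class of `s b`. -/
def IsInducedBy (s : M.GradedSection)
    (e : (freeUnstable P star M).Iso (freeAlgebra P M.omega.susp.toGradedSpace)) : Prop :=
  ∀ b, e.toLinearEquiv.symm (freeAlgebra.unit P M.omega.susp.toGradedSpace b) =
    freeUnstable.unit P star M (s.toLinearMap b)

end FreeUnstable

end UnstableOperad

end

open UnstableOperad

noncomputable section

namespace UnstableOperad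

open scoped TensorProduct

/-! Part (1). A connected reduced module `M` is a free module over `F2[Sq₀]`: given a graded section
`s`, each homogeneous `x` is `s (pr x) + Sq₀ y` with `y` of half the degree, and iterating the
decomposition stops because `M⁰ = 0`. So the values of `s` generate `M` freely under `Sq₀`, and
imposing `Sq₀ x = star(x, x)` ought to leave exactly these values as free generators.

To make this precise, give `S(P, ΣΩM)` the Frobenius `t ↦ star(t, t)`, which is additive because
`star` is commutative and the characteristic is 2. By freeness (`exists_extension`) the inclusion of
generators extends along `s` to a linear map `θ : M → S(P, ΣΩM)` that turns `Sq₀` into the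
Frobenius, and `θ` extends to a morphism of `P`-algebras on `S(P, M)`. It kills the ideal of
relations for two reasons. The Frobenius commutes with all operations by the interchange law, and
`Sq₀` does so by the Cartan formula and instability; hence `Sq₀ t + star(t, t)` is killed for every
homogeneous `t`, not only for generators. Moreover these elements already generate the ideal without
closing under Steenrod operations (`unstIdeal_le_of_isIdeal`), because `Sq^i Sq₀ = Sq₀ Sq^{i/2}` and
`Sq^i star(t, t) = star(Sq^{i/2} t, Sq^{i/2} t)`, both being zero for odd `i`. So the morphism need
not respect the other squares. Its inverse is `S(P, s)` followed by the quotient map (`exists_iso`).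

Part (2). If `star` survives in the coinvariants of `P(2)`, then `star(c, c) ≠ 0` for each generator
`c ≠ 0` of a free algebra (`Schur.mk_star_ne_zero`), so by part (1) `[Sq₀ x] ≠ 0` in `K(M)` for `x ≠
0` of odd degree. Take two `Sq₀`-towers, one on a class of degree 1 and one on a class of degree 2.
The endomorphism sending the second bottom class to `Sq₀` of the first induces zero on `ΣΩM` but not
on positive degrees of `K(M)`, which contradicts naturality. Adding `Sq₀` of the first class to the
value of a section on the second changes the induced isomorphism. -/

theorem add_self_F2 {A : Type*} [AddCommGroup A] [Module F2 A] (a : A) : a + a = 0 := by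
  rw [← two_smul F2 a, show (2 : F2) = 0 from rfl, zero_smul]

/-! ### The operation `t ↦ star(t, t)` -/

namespace PAlgebra

variable {P : Operad.{u}} {A : Type v} [AddCommGroup A] [Module F2 A]

theorem act_star_comm (alg : PAlgebra P A) {star : P.obj 2} (hcomm : P.IsCommutative star)
    (x : Fin 2 → A) : alg.act star (fun i => x (Equiv.swap 0 1 i)) = alg.act star x := by
  rw [← alg.act_relabel, hcomm]

/-- The cross terms `star(a, b)` and `star(b, a)` agree by commutativity and cancel in
characteristic 2. -/
theorem act_star_add (alg : PAlgebra P A) {star : P.obj 2} (hcomm : P.IsCommutative star)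
    (a b : A) : alg.act star (fun _ => a + b) =
      alg.act star (fun _ => a) + alg.act star (fun _ => b) := by
  have hc : ∀ x : A, (fun _ => x : Fin 2 → A) = Fin.cons x ![x] := fun x => by
    funext i; fin_cases i <;> rfl
  have hs : ∀ x y : A, alg.act star (Fin.cons x ![y]) = alg.act star (Fin.cons y ![x]) := by
    intro x y
    rw [← alg.act_star_comm hcomm (Fin.cons x ![y])]
    congr 1
    funext i
    fin_cases i <;> simp
  have hl : ∀ x y z : A, alg.act star (Fin.cons (x + y) ![z]) =
      alg.act star (Fin.cons x ![z]) + alg.act star (Fin.cons y ![z]) := fun x y z =>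
    MultilinearMap.cons_add (M := fun _ : Fin 2 => A) _ _ _ _
  have h := add_self_F2 (alg.act star (Fin.cons a ![b]))
  rw [hc (a + b), hc a, hc b, hl, hs a, hs b, hl, hl, hs b a, add_assoc,
    ← add_assoc (alg.act star (Fin.cons a ![b])), h, zero_add]

/-- The additive operation `a ↦ star(a, a)` of a commutative operation `star`. -/
def frob (alg : PAlgebra P A) {star : P.obj 2} (hcomm : P.IsCommutative star) : A →ₗ[F2] A :=
  (AddMonoidHom.mk' (fun a => alg.act star (fun _ => a)) (alg.act_star_add hcomm)).toZModLinearMap 2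

theorem frob_apply (alg : PAlgebra P A) {star : P.obj 2} (hcomm : P.IsCommutative star) (a : A) :
    alg.frob hcomm a = alg.act star (fun _ => a) := rfl

/-- The interchange law evaluated on two copies of the same tuple `x`: the Frobenius commutes with
every operation, including those of arity zero. -/
theorem act_star_act (alg : PAlgebra P A) {star : P.obj 2} (hcentral : P.IsCentral star) {n : ℕ}
    (μ : P.obj n) (x : Fin n → A) : alg.act star (fun _ => alg.act μ x) =
      alg.act μ (fun i => alg.act star (fun _ => x i)) := by
  have h := congrArg (fun ν => alg.act ν (flatten (fun _ : Fin 2 => x))) (hcentral n μ)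
  simp only [alg.act_comp, alg.act_relabel, flatten_apply] at h
  rw [h]
  congr 1
  funext i
  congr 1
  funext j
  have : blockTranspose n 2 (finSigmaFinEquiv ⟨i, j⟩) = finSigmaFinEquiv ⟨j, i⟩ := by
    simp only [blockTranspose, Equiv.trans_apply]
    rw [Equiv.symm_apply_apply]
    rfl
  rw [this, flatten_apply]

end PAlgebra

/-! ### The universal property of the free algebra -/

namespace Schur

variable {P : Operad.{u}} {V : Type v} [AddCommGroup V] [Module F2 V]

theorem exists_algLift {A : Type w} [AddCommGroup A] [Module F2 A] (alg : PAlgebra P A)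
    (θ : V →ₗ[F2] A) : ∃ L : Schur P V →ₗ[F2] A, ∀ n (μ : P.obj n) (x : Fin n → V),
      L (Schur.mk μ x) = alg.act μ (fun i => θ (x i)) := by
  refine Schur.exists_lift (fun n μ x => alg.act μ (fun i => θ (x i)))
    (fun n μ ν x => by simp) (fun n μ x i v w => ?_) (fun n σ μ x => by rw [alg.act_relabel])
  exact ((alg.act μ).compLinearMap (fun _ => θ)).map_update_add x i v w

/-- The morphism of `P`-algebras `S(P, V) → A` that extends a linear map `V → A`. -/
def algLift {A : Type w} [AddCommGroup A] [Module F2 A] (alg : PAlgebra P A)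
    (θ : V →ₗ[F2] A) : Schur P V →ₗ[F2] A := (exists_algLift alg θ).choose

theorem algLift_mk {A : Type w} [AddCommGroup A] [Module F2 A] (alg : PAlgebra P A)
    (θ : V →ₗ[F2] A) {n : ℕ} (μ : P.obj n) (x : Fin n → V) :
    algLift alg θ (Schur.mk μ x) = alg.act μ (fun i => θ (x i)) :=
  (exists_algLift alg θ).choose_spec n μ x

theorem algLift_act {A : Type w} [AddCommGroup A] [Module F2 A] (alg : PAlgebra P A)
    (θ : V →ₗ[F2] A) {n : ℕ} (μ : P.obj n) (t : Fin n → Schur P V) :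
    algLift alg θ (Schur.actMap μ t) = alg.act μ (fun i => algLift alg θ (t i)) := by
  have : (algLift alg θ).compMultilinearMap (Schur.actMap μ) =
      (alg.act μ).compLinearMap (fun _ => algLift alg θ) := by
    refine Schur.multilinear_ext (fun k ν x => ?_)
    simp only [LinearMap.compMultilinearMap_apply, MultilinearMap.compLinearMap_apply,
      Schur.actMap_mk, algLift_mk, alg.act_comp, flatten_apply]
  exact congrArg (fun F => F t) this

theorem mk_one_add (x y : V) : Schur.mk P.one (fun _ => x + y) =
    Schur.mk P.one (fun _ => x) + Schur.mk P.one (fun _ => y) := by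
  have := Schur.mk_update_add P.one (fun _ => x) 0 x y
  have h : ∀ z : V, Function.update (fun _ => x : Fin 1 → V) 0 z = fun _ => z := fun z => by
    funext i; simp [Subsingleton.elim i 0]
  simpa only [h] using this

variable (P V) in
/-- The inclusion of generators as a linear map. -/
def unitHom : V →ₗ[F2] Schur P V where
  toFun x := Schur.mk P.one (fun _ => x)
  map_add' x y := mk_one_add x y
  map_smul' c x := map_smul_of_add (fun x : V => Schur.mk P.one (fun _ => x))
    (fun x y => mk_one_add x y) c x

/-- This is how `S(P, V)` is generated by `V` as a `P`-algebra; it reduces equality of morphisms to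
equality on generators. -/
theorem actMap_unitHom {n : ℕ} (μ : P.obj n) (x : Fin n → V) :
    Schur.actMap μ (fun i => unitHom P V (x i)) = Schur.mk μ x := by
  refine (Schur.actMap_mk μ (fun _ => 1) (fun _ => P.one) (fun i _ => x i)).trans ?_
  rw [P.comp_one, Schur.mk_relabel]
  congr 1
  funext i
  simp [unitBlocks, flatten_apply]

/-- Morphisms of `P`-algebras out of `S(P, V)` agree if they agree on generators. -/
theorem hom_ext {A : Type w} [AddCommGroup A] [Module F2 A] (alg : PAlgebra P A)
    {f g : Schur P V →ₗ[F2] A}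
    (hf : ∀ {n : ℕ} (μ : P.obj n) (t : Fin n → Schur P V),
      f (Schur.actMap μ t) = alg.act μ (fun i => f (t i)))
    (hg : ∀ {n : ℕ} (μ : P.obj n) (t : Fin n → Schur P V),
      g (Schur.actMap μ t) = alg.act μ (fun i => g (t i)))
    (h : ∀ x, f (unitHom P V x) = g (unitHom P V x)) : f = g := by
  refine Schur.linear_ext fun n μ x => ?_
  rw [← actMap_unitHom, hf, hg]
  simp only [h]

/-! ### The Cartan formula -/

/-- `Schur.cartan` is defined by the Cartan formula on tuples from `V`; associativity of summation
over blocks carries the formula over to arbitrary elements of the free algebra. -/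
theorem cartan_act (T : ℕ → V →ₗ[F2] V) (d : ℕ) {n : ℕ} (μ : P.obj n) (t : Fin n → Schur P V) :
    Schur.cartan P T d (Schur.actMap μ t) = ∑ a ∈ Finset.Nat.antidiagonalTuple n d,
      Schur.actMap μ (fun i => Schur.cartan P T (a i) (t i)) := by
  have : (Schur.cartan P T d).compMultilinearMap (Schur.actMap μ) =
      ∑ a ∈ Finset.Nat.antidiagonalTuple n d,
        (Schur.actMap μ).compLinearMap (fun i => Schur.cartan P T (a i)) := by
    refine Schur.multilinear_ext (fun k ν x => ?_)
    simp only [LinearMap.compMultilinearMap_apply, sum_apply,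
      MultilinearMap.compLinearMap_apply, Schur.actMap_mk, Schur.cartan_mk]
    have h : ∀ a : Fin n → ℕ, Schur.actMap μ (fun i => ∑ b ∈ Finset.Nat.antidiagonalTuple (k i) (a i),
          Schur.mk (ν i) (fun j => T (b j) (x i j))) =
        ∑ b ∈ Fintype.piFinset (fun i => Finset.Nat.antidiagonalTuple (k i) (a i)),
          Schur.mk (P.comp k μ ν) (flatten fun i j => T (b i j) (x i j)) := by
      intro a
      rw [MultilinearMap.map_sum_finset]
      simp only [Schur.actMap_mk]
    simp only [h]
    rw [Finset.sum_sigma']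
    -- A distribution of `d` over all inputs of the composite is the same as a distribution over the
    -- `n` blocks, given by the block sums, together with a distribution within each block.
    refine Finset.sum_bij' (fun c _ => ⟨fun i => ∑ j, c (finSigmaFinEquiv ⟨i, j⟩),
        fun i j => c (finSigmaFinEquiv ⟨i, j⟩)⟩) (fun p _ => flatten p.2) ?_ ?_ ?_ ?_ ?_
    · intro c hc
      rw [Finset.Nat.mem_antidiagonalTuple] at hc
      simp only [Finset.mem_sigma, Finset.Nat.mem_antidiagonalTuple, Fintype.mem_piFinset,
        implies_true, and_true]
      rw [← hc, ← Equiv.sum_comp finSigmaFinEquiv, Fintype.sum_sigma]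
    · rintro ⟨a, b⟩ hp
      simp only [Finset.mem_sigma, Finset.Nat.mem_antidiagonalTuple, Fintype.mem_piFinset] at hp
      rw [Finset.Nat.mem_antidiagonalTuple, ← Equiv.sum_comp finSigmaFinEquiv, Fintype.sum_sigma,
        ← hp.1]
      exact Finset.sum_congr rfl fun i _ => by simp only [flatten_apply, hp.2]
    · intro c _
      funext t
      obtain ⟨p, rfl⟩ := finSigmaFinEquiv.surjective t
      rw [flatten_apply]
    · rintro ⟨a, b⟩ hp
      simp only [Finset.mem_sigma, Finset.Nat.mem_antidiagonalTuple, Fintype.mem_piFinset] at hp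
      simp only [flatten_apply, hp.2]
    · intro c _
      congr 1
      funext t
      obtain ⟨p, rfl⟩ := finSigmaFinEquiv.surjective t
      simp only [flatten_apply]
  simpa [sum_apply] using congrArg (fun F => F t) this

end Schur

/-! ### Squares and the operation `Sq₀` -/

/-- This says `Sq^i Sq₀ = Sq₀ Sq^{i/2}`, read as zero for odd `i`. In the Adem relation for `Sq^i
Sq^d` with `i < 2d`, the term `Sq^{i+d-k} Sq^k x` exceeds the degree `d + k` of `Sq^k x` unless `2k
= i`, and that term has coefficient 1. -/
theorem UnstableModule.sq_sq_self (M : UnstableModule.{v}) (i d : ℕ) (x : M.carrier)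
    (hx : x ∈ M.deg d) : M.sq i (M.sq d x) =
      if Even i then M.sq (d + i / 2) (M.sq (i / 2) x) else 0 := by
  rcases Nat.eq_zero_or_pos i with rfl | hi
  · have h0 : ∀ y, M.sq 0 y = y := fun y => by rw [UnstableModule.sq, Sq_zero, map_one]; rfl
    simp [h0]
  rcases Nat.lt_or_ge i (2 * d) with h | h
  · have h1 : M.sq i (M.sq d x) = M.act (Sq i * Sq d) x := by rw [map_mul]; rfl
    rw [h1, Sq_adem i d hi h, map_sum, LinearMap.sum_apply]
    simp only [map_smul, map_mul, LinearMap.smul_apply]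
    have hz : ∀ k ∈ Finset.range (i / 2 + 1), 2 * k ≠ i →
        ((Nat.choose (d - k - 1) (i - 2 * k) : ℕ) : F2) • (M.act (Sq (i + d - k)) *
          M.act (Sq k)) x = 0 := by
      intro k hk hki
      rw [Finset.mem_range] at hk
      have : M.act (Sq (i + d - k)) (M.act (Sq k) x) = 0 :=
        M.unstable _ _ _ (M.sq_mem k d x hx) (by omega)
      rw [Module.End.mul_apply, this, smul_zero]
    split_ifs with he
    · obtain ⟨k, rfl⟩ := he
      rw [Finset.sum_eq_single k (fun b hb hbk => hz b hb (by omega))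
        (fun hk => absurd (Finset.mem_range.2 (by omega)) hk)]
      have e1 : (k + k) / 2 = k := by omega
      have e2 : k + k + d - k = d + k := by omega
      have e3 : k + k - 2 * k = 0 := by omega
      rw [e1, e2, e3]
      simp [UnstableModule.sq]
    · refine Finset.sum_eq_zero fun k hk => hz k hk ?_
      rintro rfl
      exact he (even_two_mul k)
  -- Outside the range of the Adem relations the two sides coincide literally for `i = 2d`, and both
  -- vanish by instability for `i > 2d`.
  · rcases h.eq_or_lt with rfl | h
    · have e1 : 2 * d / 2 = d := by omega
      rw [if_pos (even_two_mul d), e1, two_mul]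
    · have h1 : M.sq i (M.sq d x) = 0 := M.unstable _ _ _ (M.sq_mem d d x hx) (by omega)
      rw [h1]
      split_ifs with he
      · obtain ⟨k, rfl⟩ := he
        have : M.sq ((k + k) / 2) x = 0 := M.unstable _ _ _ hx (by omega)
        rw [this, map_zero]
      · rfl

/-! ### Steenrod operations on `S(P, M)` and stability of the relations -/

section

variable (P : Operad.{u}) (M : UnstableModule.{v})

/-- The operation `Sq^i` on `S(P, M)`, as an endomorphism of the Schur functor. -/
abbrev Schur.sq (i : ℕ) : Schur P M.carrier →ₗ[F2] Schur P M.carrier := Schur.cartan P M.sq i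

theorem Schur.sq_act (i : ℕ) {n : ℕ} (μ : P.obj n) (t : Fin n → Schur P M.carrier) :
    Schur.sq P M i (Schur.actMap μ t) = ∑ a ∈ Finset.Nat.antidiagonalTuple n i,
      Schur.actMap μ (fun j => Schur.sq P M (a j) (t j)) :=
  Schur.cartan_act M.sq i μ t

theorem Schur.sq_mk (i : ℕ) {n : ℕ} (μ : P.obj n) (x : Fin n → M.carrier) :
    Schur.sq P M i (Schur.mk μ x) = ∑ a ∈ Finset.Nat.antidiagonalTuple n i,
      Schur.mk μ (fun j => M.sq (a j) (x j)) :=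
  Schur.cartan_mk P M.sq i μ x

/-- The top square acts input by input: a tuple `b ≠ a` with the same sum has some `b i > a i`, and
then instability kills that factor. Thus `Sq₀` commutes with all operations. -/
theorem Schur.sq_self_mk {n : ℕ} (μ : P.obj n) (a : Fin n → ℕ) (x : Fin n → M.carrier)
    (hx : ∀ i, x i ∈ M.deg (a i)) : Schur.sq P M (∑ i, a i) (Schur.mk μ x) =
      Schur.mk μ (fun i => M.sq (a i) (x i)) := by
  rw [Schur.sq_mk]
  refine Finset.sum_eq_single a (fun b hb hba => ?_)
    (fun h => absurd (Finset.Nat.mem_antidiagonalTuple.2 rfl) h)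
  rw [Finset.Nat.mem_antidiagonalTuple] at hb
  obtain ⟨i, hi⟩ : ∃ i, a i < b i := by
    by_contra! h
    exact hba (funext fun i => (Finset.sum_eq_sum_iff_of_le (fun i _ => h i)).1 hb i
      (Finset.mem_univ i))
  exact Schur.mk_zero_of P μ _ i (M.unstable _ _ _ (hx i) hi)

theorem Schur.sq_mem_deg (i d : ℕ) (t : Schur P M.carrier) (ht : t ∈ Schur.deg P M.toGradedSpace d) :
    Schur.sq P M i t ∈ Schur.deg P M.toGradedSpace (d + i) := by
  refine (Submodule.span_le.2 ?_ : Schur.deg P M.toGradedSpace d ≤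
    (Schur.deg P M.toGradedSpace (d + i)).comap (Schur.sq P M i)) ht
  rintro _ ⟨n, μ, a, x, hx, rfl, rfl⟩
  rw [SetLike.mem_coe, Submodule.mem_comap, Schur.sq_mk]
  refine Submodule.sum_mem _ fun b hb => ?_
  rw [Finset.Nat.mem_antidiagonalTuple] at hb
  rw [← hb, ← Finset.sum_add_distrib]
  exact Schur.mk_mem_deg P μ _ _ (fun j => M.sq_mem _ _ _ (hx j))

/-- By linearity `t` may be a generator with homogeneous entries. There `Sq₀` acts entrywise, the
identity for `M` applies to each entry, and only tuples with all entries even contribute. -/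
theorem Schur.sq_sq_self (i d : ℕ) (t : Schur P M.carrier)
    (ht : t ∈ Schur.deg P M.toGradedSpace d) : Schur.sq P M i (Schur.sq P M d t) =
      if Even i then Schur.sq P M (d + i / 2) (Schur.sq P M (i / 2) t) else 0 := by
  suffices H : Schur.deg P M.toGradedSpace d ≤ LinearMap.eqLocus (Schur.sq P M i ∘ₗ Schur.sq P M d)
      (if Even i then Schur.sq P M (d + i / 2) ∘ₗ Schur.sq P M (i / 2) else 0) by
    have := H ht
    rw [LinearMap.mem_eqLocus] at this
    split_ifs at this ⊢ with h <;> exact this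
  refine Submodule.span_le.2 ?_
  rintro _ ⟨n, μ, a, x, hx, rfl, rfl⟩
  rw [SetLike.mem_coe, LinearMap.mem_eqLocus, LinearMap.comp_apply]
  rw [Schur.sq_self_mk P M μ a x hx, Schur.sq_mk]
  simp only [fun (b : Fin n → ℕ) j => M.sq_sq_self (b j) (a j) (x j) (hx j)]
  have hz : ∀ b : Fin n → ℕ, (∃ j, ¬ Even (b j)) → Schur.mk μ (fun j => if Even (b j) then
      M.sq (a j + b j / 2) (M.sq (b j / 2) (x j)) else 0) = 0 := by
    rintro b ⟨j, hj⟩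
    exact Schur.mk_zero_of P μ _ j (if_neg hj)
  split_ifs with hi
  · obtain ⟨k, rfl⟩ := hi
    have ek : (k + k) / 2 = k := by omega
    rw [LinearMap.comp_apply, ek, Schur.sq_mk, map_sum]
    have h1 : ∀ c ∈ Finset.Nat.antidiagonalTuple n k,
        Schur.sq P M (∑ j, a j + k) (Schur.mk μ fun j => M.sq (c j) (x j)) =
          Schur.mk μ (fun j => M.sq (a j + c j) (M.sq (c j) (x j))) := by
      intro c hc
      rw [Finset.Nat.mem_antidiagonalTuple] at hc
      rw [← hc, ← Finset.sum_add_distrib]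
      exact Schur.sq_self_mk P M μ (fun j => a j + c j) _ (fun j => M.sq_mem _ _ _ (hx j))
    rw [Finset.sum_congr rfl h1]
    symm
    -- The surviving tuples are exactly the doubles `c + c` of the tuples `c` with sum `i / 2`.
    refine Finset.sum_of_injOn (fun c j => c j + c j) ?_ ?_ ?_ ?_
    · intro c _ c' _ h
      funext j
      have := congrFun h j
      simp only at this
      omega
    · intro c hc
      simp only [Finset.mem_coe, Finset.Nat.mem_antidiagonalTuple] at hc ⊢
      rw [Finset.sum_add_distrib, hc]
    · intro b hb hb'
      apply hz
      by_contra! hev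
      apply hb'
      choose c hc using hev
      refine ⟨c, ?_, (funext hc).symm⟩
      simp only [Finset.mem_coe, Finset.Nat.mem_antidiagonalTuple] at hb ⊢
      simp only [hc, Finset.sum_add_distrib] at hb
      omega
    · intro c _
      congr 1
      funext j
      have ec : (c j + c j) / 2 = c j := by omega
      rw [if_pos ⟨c j, rfl⟩, ec]
  · change _ = (0 : Schur P M.carrier)
    refine Finset.sum_eq_zero fun b hb => hz b ?_
    by_contra! hev
    rw [Finset.Nat.mem_antidiagonalTuple] at hb
    exact hi (hb ▸ Finset.even_sum _ (fun j _ => hev j))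

variable {P} {star : P.obj 2}

/-- In the Cartan formula the terms `(a, b)` and `(b, a)` with `a ≠ b` are equal by commutativity
and cancel in pairs, so only the diagonal term `(i/2, i/2)` can remain. -/
theorem Schur.sq_act_star (hcomm : P.IsCommutative star) (i : ℕ) (t : Schur P M.carrier) :
    Schur.sq P M i (Schur.actMap star (fun _ => t)) =
      if Even i then Schur.actMap star (fun _ => Schur.sq P M (i / 2) t) else 0 := by
  rw [Schur.sq_act]
  have hinv : ∀ s : Finset (Fin 2 → ℕ), (∀ a ∈ s, a 0 ≠ a 1) →
      (∀ a ∈ s, a ∘ Equiv.swap 0 1 ∈ s) →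
      ∑ a ∈ s, Schur.actMap star (fun j => Schur.sq P M (a j) t) = 0 := by
    intro s hs hs'
    refine Finset.sum_involution (fun a _ => a ∘ Equiv.swap 0 1) (fun a _ => ?_)
      (fun a ha _ h => ?_) (fun a ha => hs' a ha) (fun a _ => ?_)
    · have := (Schur.algebra P M.carrier).act_star_comm hcomm (fun j => Schur.sq P M (a j) t)
      change _ + (Schur.algebra P M.carrier).act star _ = 0
      simp only [Function.comp_apply]
      rw [this]
      exact add_self_F2 _
    · exact hs a ha (by simpa using congrFun h 1)
    · funext j
      simp
  have hmem : ∀ a ∈ Finset.Nat.antidiagonalTuple 2 i,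
      a ∘ Equiv.swap (0 : Fin 2) 1 ∈ Finset.Nat.antidiagonalTuple 2 i := by
    intro a ha
    rw [Finset.Nat.mem_antidiagonalTuple] at ha ⊢
    rw [← ha]
    exact Equiv.sum_comp _ a
  split_ifs with hi
  · obtain ⟨k, rfl⟩ := hi
    have ek : (k + k) / 2 = k := by omega
    have hk : (fun _ => k) ∈ Finset.Nat.antidiagonalTuple 2 (k + k) := by
      rw [Finset.Nat.mem_antidiagonalTuple]; simp [two_mul]
    have hcase : ∀ a ∈ Finset.Nat.antidiagonalTuple 2 (k + k), a 0 = a 1 → a = fun _ => k := by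
      intro a ha h
      rw [Finset.Nat.mem_antidiagonalTuple, Fin.sum_univ_two] at ha
      funext j
      fin_cases j <;> simp <;> omega
    rw [ek, ← Finset.add_sum_erase _ _ hk, hinv, add_zero]
    · intro a ha h
      rw [Finset.mem_erase] at ha
      exact ha.1 (hcase a ha.2 h)
    · intro a ha
      rw [Finset.mem_erase] at ha ⊢
      refine ⟨fun h => ha.1 ?_, hmem a ha.2⟩
      have h0 := congrFun h 0
      have h1 := congrFun h 1
      simp at h0 h1
      funext j
      fin_cases j <;> simp [h0, h1]
  · refine hinv _ (fun a ha h => hi ?_) hmem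
    rw [Finset.Nat.mem_antidiagonalTuple, Fin.sum_univ_two] at ha
    exact ⟨a 0, by omega⟩

/-- For even `i` the relation of `t` goes to the relation of `Sq^{i/2} t`; for odd `i` it goes to
zero. -/
theorem sqFree_mem_unstRel (hcomm : P.IsCommutative star) (i : ℕ) (r : Schur P M.carrier)
    (hr : r ∈ unstRel P star M) : sqFree P M i r ∈ unstRel P star M := by
  obtain ⟨d, t, ht, rfl⟩ := hr
  rw [map_add]
  have h1 := Schur.sq_sq_self P M i d t ht
  have h2 := Schur.sq_act_star M hcomm i t
  by_cases hi : Even i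
  · rw [if_pos hi] at h1 h2
    refine ⟨d + i / 2, sqFree P M (i / 2) t, Schur.sq_mem_deg P M _ _ _ ht, ?_⟩
    exact congrArg₂ (fun a b : Schur P M.carrier => a + b) h1 h2
  · rw [if_neg hi] at h1 h2
    -- Zero is itself a relation, namely that of `t = 0`.
    refine ⟨0, 0, Submodule.zero_mem _, ?_⟩
    exact congrArg₂ (fun a b : Schur P M.carrier => a + b) (h1.trans (map_zero _).symm)
      (h2.trans (MultilinearMap.map_coord_zero (Schur.actMap star) 0 rfl).symm)

/-- A homogeneous ideal that contains all `Sq₀ t + star(t, t)` contains the whole ideal of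
relations, because these elements are permuted by the Steenrod operations. -/
theorem unstIdeal_le_of_isIdeal (hcomm : P.IsCommutative star)
    (J : Submodule F2 (freeAlgebra P M.toGradedSpace).carrier)
    (hJ : (freeAlgebra P M.toGradedSpace).IsIdeal J)
    (hJ' : (freeAlgebra P M.toGradedSpace).IsHomogeneous J) (hr : unstRel P star M ⊆ J) :
    unstIdeal P star M ≤ J := by
  let A := freeAlgebra P M.toGradedSpace
  -- `J` itself need not be stable under the squares. The smallest homogeneous ideal `I` containing
  -- the relations turns out to be stable, and it lies in `J`.
  let I : Submodule F2 A.carrier :=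
    sInf {I | A.IsIdeal I ∧ A.IsHomogeneous I ∧ unstRel P star M ⊆ I}
  have mem_I : ∀ t, t ∈ I ↔ ∀ I', A.IsIdeal I' ∧ A.IsHomogeneous I' ∧ unstRel P star M ⊆ I' →
      t ∈ I' := fun t => Submodule.mem_sInf
  have hI : A.IsIdeal I := fun μ x i hx => by
    rw [mem_I] at hx ⊢
    exact fun I' h => h.1 μ x i (hx I' h)
  have hI' : A.IsHomogeneous I := fun d x hx => by
    rw [mem_I] at hx ⊢
    exact fun I' h => h.2.1 d x (hx I' h)
  have hIr : unstRel P star M ⊆ I := fun r h => by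
    rw [SetLike.mem_coe, mem_I]
    exact fun I' h' => h'.2.2 h
  have hproj : ∀ i d t, sqFree P M i (A.proj d t) = A.proj (d + i) (sqFree P M i t) := by
    intro i d t
    have : sqFree P M i ∘ₗ A.proj d = A.proj (d + i) ∘ₗ sqFree P M i := by
      refine A.linear_ext fun e x hx => ?_
      have hx' : sqFree P M i x ∈ A.deg (e + i) := Schur.sq_mem_deg P M i e x hx
      by_cases h : e = d
      · subst h
        rw [LinearMap.comp_apply, LinearMap.comp_apply, A.isProjFamily.self _ _ hx,
          A.isProjFamily.self _ _ hx']
      · rw [LinearMap.comp_apply, LinearMap.comp_apply, A.isProjFamily.ne _ _ _ h hx,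
          A.isProjFamily.ne _ _ _ (by omega) hx', map_zero]
    exact LinearMap.congr_fun this t
  -- The elements all of whose squares lie in `I`. They form a homogeneous ideal by the Cartan
  -- formula and include the relations, so minimality gives `I ≤ I₂`, which is the stability of `I`.
  let I₂ : Submodule F2 A.carrier := ⨅ i, I.comap (sqFree P M i)
  have mem_I₂ : ∀ t, t ∈ I₂ ↔ ∀ i, sqFree P M i t ∈ I := fun t => by simp [I₂]
  have hle : I ≤ I₂ := by
    refine sInf_le ⟨fun μ x j hx => ?_, fun d x hx => ?_, fun r h => ?_⟩
    · rw [mem_I₂] at hx ⊢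
      intro i
      have := Schur.sq_act P M i μ x
      refine (congrArg (· ∈ I) this).mpr (Submodule.sum_mem _ fun a _ => ?_)
      exact hI μ _ j (hx (a j))
    · rw [mem_I₂] at hx ⊢
      intro i
      rw [hproj]
      exact hI' _ _ (hx i)
    · rw [SetLike.mem_coe, mem_I₂]
      exact fun i => hIr (sqFree_mem_unstRel M hcomm i r h)
  refine le_trans (sInf_le ⟨⟨hI, hI', fun i t ht => (mem_I₂ t).1 (hle ht) i⟩, hIr⟩ :
    unstIdeal P star M ≤ I) (sInf_le ⟨hJ, hJ', hr⟩)

end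

/-! ### Graded linear algebra -/

namespace GradedSpace

variable (V : GradedSpace.{v})

theorem exists_linear {Z : Type w} [AddCommGroup Z] [Module F2 Z] (f : ℕ → V.carrier →ₗ[F2] Z) :
    ∃ L : V.carrier →ₗ[F2] Z, ∀ d x, x ∈ V.deg d → L x = f d x := by
  refine ⟨DirectSum.toModule F2 ℕ Z (fun d => f d ∘ₗ (V.deg d).subtype) ∘ₗ
    V.equiv.symm.toLinearMap, fun d x hx => ?_⟩
  have : V.equiv.symm x = DirectSum.lof F2 ℕ (fun d => V.deg d) d ⟨x, hx⟩ := by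
    rw [LinearEquiv.symm_apply_eq]
    exact (DirectSum.coeLinearMap_lof V.deg d ⟨x, hx⟩).symm
  rw [LinearMap.comp_apply, LinearEquiv.coe_coe, this, DirectSum.toModule_lof]
  rfl

theorem proj_mem (d : ℕ) (x : V.carrier) : V.proj d x ∈ V.deg d := Subtype.property _

theorem eq_zero_of_proj (x : V.carrier) (h : ∀ d, V.proj d x = 0) : x = 0 := by
  rw [← V.equiv.symm.map_eq_zero_iff]
  refine DFinsupp.ext fun d => Subtype.ext ?_
  exact h d

theorem mem_deg_of_proj (d : ℕ) (x : V.carrier) (h : ∀ e, e ≠ d → V.proj e x = 0) :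
    x ∈ V.deg d := by
  have : x - V.proj d x = 0 := V.eq_zero_of_proj _ fun e => by
    by_cases he : e = d
    · subst he
      rw [map_sub, V.isProjFamily.self _ _ (V.proj_mem e x), sub_self]
    · rw [map_sub, h e he, V.isProjFamily.ne _ _ _ (Ne.symm he) (V.proj_mem d x), sub_zero]
  rw [sub_eq_zero.1 this]
  exact V.proj_mem d x

end GradedSpace

/-! ### The linear map `Sq₀` and graded sections of its cokernel -/

namespace UnstableModule

variable (M : UnstableModule.{v})

theorem sq_mem_deg {d : ℕ} {x : M.carrier} (hx : x ∈ M.deg d) : M.sq d x ∈ M.deg (d + d) :=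
  M.sq_mem d d x hx

/-- The linear map `Sq₀ : M → M`. -/
def sq0 : M.carrier →ₗ[F2] M.carrier := (M.toGradedSpace.exists_linear M.sq).choose

theorem sq0_apply {d : ℕ} {x : M.carrier} (hx : x ∈ M.deg d) : M.sq0 x = M.sq d x :=
  (M.toGradedSpace.exists_linear M.sq).choose_spec d x hx

theorem proj_double_sq0 (e : ℕ) (x : M.carrier) : M.proj (e + e) (M.sq0 x) = M.sq0 (M.proj e x) := by
  have : M.proj (e + e) ∘ₗ M.sq0 = M.sq0 ∘ₗ M.proj e := by
    refine M.toGradedSpace.linear_ext fun d x hx => ?_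
    rw [LinearMap.comp_apply, LinearMap.comp_apply, M.sq0_apply hx]
    by_cases h : d = e
    · subst h
      rw [M.isProjFamily.self _ _ (M.sq_mem_deg hx), M.isProjFamily.self _ _ hx, M.sq0_apply hx]
    · rw [M.isProjFamily.ne _ _ _ (by omega) (M.sq_mem_deg hx), M.isProjFamily.ne _ _ _ h hx,
        map_zero]
  exact LinearMap.congr_fun this x

theorem proj_odd_sq0 (d : ℕ) (hd : ∀ e, d ≠ e + e) (x : M.carrier) : M.proj d (M.sq0 x) = 0 := by
  have : M.proj d ∘ₗ M.sq0 = 0 := by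
    refine M.toGradedSpace.linear_ext fun e x hx => ?_
    rw [LinearMap.comp_apply, M.sq0_apply hx]
    exact M.isProjFamily.ne _ _ _ (hd e).symm (M.sq_mem_deg hx)
  exact LinearMap.congr_fun this x

theorem range_sq0 : LinearMap.range M.sq0 = M.imSq0 := by
  apply le_antisymm
  · rw [LinearMap.range_eq_map, ← M.isProjFamily.sup, Submodule.map_iSup]
    refine iSup_le fun d => ?_
    rintro _ ⟨x, hx, rfl⟩
    rw [M.sq0_apply hx]
    exact M.sq_mem_imSq0 hx
  · refine iSup_le fun d => ?_
    rintro _ ⟨x, hx, rfl⟩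
    exact ⟨x, M.sq0_apply hx⟩

variable {M}

/-- `IsReduced` concerns homogeneous elements only; since `Sq₀` sends distinct degrees to distinct
degrees, injectivity can be tested on components. -/
theorem IsReduced.sq0_injective (h : M.IsReduced) : Function.Injective M.sq0 := by
  rw [injective_iff_map_eq_zero]
  intro x hx
  refine M.eq_zero_of_proj x fun d => h d _ (M.proj_mem d x) ?_
  rw [← M.sq0_apply (M.proj_mem d x), ← M.proj_double_sq0, hx, map_zero]

/-- The suspension is zero in degree 0 by construction, so that case needs an argument: `Sq₀` is the
identity on `M⁰`, hence `pr` kills `M⁰`. -/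
theorem pr_mem_deg (d : ℕ) (x : M.carrier) (hx : x ∈ M.deg d) :
    M.pr x ∈ M.omega.susp.deg d := by
  cases d with
  | zero =>
    have h0 := M.sq_mem_imSq0 hx
    rw [sq, Sq_zero, map_one] at h0
    exact (Submodule.Quotient.mk_eq_zero M.imSq0).2 h0
  | succ d => exact ⟨x, hx, rfl⟩

theorem pr_sq (d : ℕ) (x : M.carrier) (hx : x ∈ M.deg d) : M.pr (M.sq d x) = 0 :=
  (Submodule.Quotient.mk_eq_zero M.imSq0).2 (M.sq_mem_imSq0 hx)

theorem pr_eq_zero_iff (x : M.carrier) : M.pr x = 0 ↔ x ∈ LinearMap.range M.sq0 := by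
  rw [range_sq0]
  exact Submodule.Quotient.mk_eq_zero M.imSq0

variable (M) in
-- An arbitrary linear section becomes graded on replacing its value at each `b` of degree `d` by
-- the component of degree `d`.
theorem nonempty_gradedSection : Nonempty M.GradedSection := by
  have hsurj : Function.Surjective M.pr := M.imSq0.mkQ_surjective
  obtain ⟨s₀, hs₀⟩ := M.pr.exists_rightInverse_of_surjective (LinearMap.range_eq_top.2 hsurj)
  obtain ⟨s, hs⟩ := M.omega.susp.toGradedSpace.exists_linear (fun d => M.proj d ∘ₗ s₀)
  refine ⟨s, fun d b hb => ?_, fun b => ?_⟩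
  · rw [hs d b hb]
    exact M.proj_mem d _
  · have : M.pr ∘ₗ s = LinearMap.id := by
      refine M.omega.susp.toGradedSpace.linear_ext fun d b hb => ?_
      have h1 : M.pr (M.proj d (s₀ b)) = M.omega.susp.proj d (M.pr (s₀ b)) :=
        GradedSpace.map_proj (W := M.omega.susp.toGradedSpace) M.pr pr_mem_deg d (s₀ b)
      have h2 : M.pr (s₀ b) = b := LinearMap.congr_fun hs₀ b
      rw [LinearMap.comp_apply, hs d b hb, LinearMap.comp_apply, h1, h2,
        M.omega.susp.isProjFamily.self d b hb]
      rfl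
    exact LinearMap.congr_fun this b

/-! ### Freeness of connected reduced modules over `F2[Sq₀]` -/

namespace GradedSection

variable (s : M.GradedSection)

theorem sub_mem_range (x : M.carrier) : x - s.toLinearMap (M.pr x) ∈ LinearMap.range M.sq0 := by
  rw [← pr_eq_zero_iff, map_sub, s.pr_apply, sub_self]

theorem map_pr_mem_deg {d : ℕ} {x : M.carrier} (hx : x ∈ M.deg d) :
    s.toLinearMap (M.pr x) ∈ M.deg d :=
  s.map_deg d _ (pr_mem_deg d x hx)

/-- Every homogeneous element of a connected module is built from the values of a section by
sums and `Sq₀`. -/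
theorem induction (hM : M.IsConnected) {C : ℕ → M.carrier → Prop}
    (zero : ∀ d, C d 0)
    (base : ∀ d b, b ∈ M.omega.susp.deg d → C d (s.toLinearMap b))
    (sq : ∀ d x, x ∈ M.deg d → C d x → C (d + d) (M.sq d x))
    (add : ∀ d x y, C d x → C d y → C d (x + y))
    (d : ℕ) (x : M.carrier) (hx : x ∈ M.deg d) : C d x := by
  induction d using Nat.strong_induction_on generalizing x with
  | _ d ih =>
    rcases Nat.eq_zero_or_pos d with rfl | hd
    · have hx0 : x = 0 := by
        rw [hM] at hx
        exact hx
      exact hx0 ▸ zero 0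
    have hz : x - s.toLinearMap (M.pr x) ∈ M.deg d := Submodule.sub_mem _ hx (s.map_pr_mem_deg hx)
    rw [← add_sub_cancel (s.toLinearMap (M.pr x)) x]
    refine add _ _ _ (base d _ (pr_mem_deg d x hx)) ?_
    obtain ⟨y, hy⟩ := s.sub_mem_range x
    -- The preimage `y` need not be homogeneous. Projecting `Sq₀ y` to degree `d` replaces `y` by
    -- its component of degree `d / 2`, or gives zero when `d` is odd.
    rw [← M.isProjFamily.self d _ hz, ← hy]
    by_cases h : ∃ e, d = e + e
    · obtain ⟨e, rfl⟩ := h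
      rw [M.proj_double_sq0, M.sq0_apply (M.proj_mem e y)]
      exact sq e _ (M.proj_mem e y) (ih e (by omega) _ (M.proj_mem e y))
    · push Not at h
      rw [M.proj_odd_sq0 d h]
      exact zero d

/-- A connected reduced module is a free module over `F2[Sq₀]`: linear maps out of it that are
compatible with `Sq₀` can be prescribed freely on the values of a section. -/
theorem exists_extension (hM : M.IsConnected) (hM' : M.IsReduced) {A : Type w} [AddCommGroup A]
    [Module F2 A] (F : A →ₗ[F2] A) (f : M.omega.susp.carrier →ₗ[F2] A) :
    ∃ θ : M.carrier →ₗ[F2] A, (∀ b, θ (s.toLinearMap b) = f b) ∧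
      ∀ d x, x ∈ M.deg d → θ (M.sq d x) = F (θ x) := by
  obtain ⟨ρ, hρ⟩ := M.sq0.exists_leftInverse_of_injective
    (LinearMap.ker_eq_bot.2 hM'.sq0_injective)
  have hρ' : ∀ x, ρ (M.sq0 x) = x := fun x => LinearMap.congr_fun hρ x
  -- `ψ` removes the component along the section and divides by `Sq₀`, so that `x = s (pr x) + Sq₀
  -- (ψ x)`.
  let ψ : M.carrier →ₗ[F2] M.carrier := ρ ∘ₗ (LinearMap.id - s.toLinearMap ∘ₗ M.pr)
  have hψ : ∀ x, ψ x = ρ (x - s.toLinearMap (M.pr x)) := fun x => rfl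
  have sq0_ψ : ∀ x, M.sq0 (ψ x) = x - s.toLinearMap (M.pr x) := by
    intro x
    obtain ⟨y, hy⟩ := s.sub_mem_range x
    rw [hψ, ← hy, hρ']
  have ψ_sq0 : ∀ x, ψ (M.sq0 x) = x := by
    intro x
    have : M.pr (M.sq0 x) = 0 := (pr_eq_zero_iff _).2 ⟨x, rfl⟩
    rw [hψ, this, map_zero, sub_zero, hρ']
  have ψ_s : ∀ b, ψ (s.toLinearMap b) = 0 := by
    intro b
    rw [hψ, s.pr_apply, sub_self, map_zero]
  -- The left inverse `ρ` was chosen without regard to degrees. Injectivity of `Sq₀` nevertheless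
  -- forces `ψ` to halve degrees and to vanish in odd ones.
  have ψ_deg : ∀ d x, x ∈ M.deg d → ψ x = 0 ∨ ∃ e, d = e + e ∧ ψ x ∈ M.deg e := by
    intro d x hx
    have hz : M.sq0 (ψ x) ∈ M.deg d := by
      rw [sq0_ψ]
      exact Submodule.sub_mem _ hx (s.map_pr_mem_deg hx)
    have key : ∀ e, e + e ≠ d → M.proj e (ψ x) = 0 := by
      intro e he
      apply hM'.sq0_injective
      rw [← M.proj_double_sq0, M.isProjFamily.ne _ _ _ he.symm hz, map_zero]
    by_cases h : ∃ e, d = e + e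
    · obtain ⟨e, rfl⟩ := h
      exact Or.inr ⟨e, rfl, M.mem_deg_of_proj e _ fun e' he' => key e' (by omega)⟩
    · push Not at h
      exact Or.inl (M.eq_zero_of_proj _ fun e => key e (h e).symm)
  -- Positive degrees strictly decrease under halving, and `M⁰ = 0`; the bound `d ≤ n` is generous
  -- but suffices.
  have ψ_pow : ∀ d n x, x ∈ M.deg d → d ≤ n → (ψ ^ n) x = 0 := by
    intro d
    induction d using Nat.strong_induction_on with
    | _ d ih =>
      intro n x hx hn
      rcases Nat.eq_zero_or_pos d with rfl | hd
      · have hx0 : x = 0 := by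
          rw [hM] at hx
          exact hx
        rw [hx0, map_zero]
      obtain ⟨n, rfl⟩ : ∃ m, n = m + 1 := ⟨n - 1, by omega⟩
      rw [pow_succ, Module.End.mul_apply]
      rcases ψ_deg d x hx with h | ⟨e, rfl, h⟩
      · rw [h, map_zero]
      · exact ih e (by omega) n _ h (by omega)
  -- Iterating the decomposition yields `x = ∑ Sq₀^n (s (pr (ψ^n x)))`, so `θ` must be `∑ F^n ∘ f ∘
  -- pr ∘ ψ^n`, a finite sum in each degree.
  let g : ℕ → M.carrier →ₗ[F2] A := fun n => (F ^ n) ∘ₗ f ∘ₗ M.pr ∘ₗ (ψ ^ n)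
  have hg : ∀ n x, g n x = (F ^ n) (f (M.pr ((ψ ^ n) x))) := fun n x => rfl
  obtain ⟨θ, hθ⟩ := M.toGradedSpace.exists_linear (fun d => ∑ n ∈ Finset.range d, g n)
  have hθ' : ∀ d N x, x ∈ M.deg d → d ≤ N → θ x = ∑ n ∈ Finset.range N, g n x := by
    intro d N x hx hN
    rw [hθ d x hx, LinearMap.sum_apply]
    refine Finset.sum_subset (Finset.range_mono hN) fun n _ hn => ?_
    rw [hg, ψ_pow d n x hx (by simpa using hn)]
    simp
  refine ⟨θ, fun b => ?_, fun d x hx => ?_⟩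
  · have : θ ∘ₗ s.toLinearMap = f := by
      refine M.omega.susp.toGradedSpace.linear_ext fun d b hb => ?_
      -- The bound `d + 1` guarantees that the term `n = 0` is present even for `d = 0`; the later
      -- terms vanish because `ψ ∘ s = 0`.
      rw [LinearMap.comp_apply, hθ' d (d + 1) _ (s.map_deg d b hb) (Nat.le_succ d),
        Finset.sum_range_succ', Finset.sum_eq_zero, zero_add]
      · rw [hg]
        simp [s.pr_apply]
      · intro n _
        rw [hg, pow_succ, pow_succ, Module.End.mul_apply, Module.End.mul_apply, ψ_s]
        simp
    exact LinearMap.congr_fun this b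
  -- One more summand is used for `Sq₀ x` than for `x`: its term `n = 0` vanishes since `pr ∘ Sq₀ =
  -- 0`, and its term `n + 1` is `F` of the term `n` for `x`, since `ψ ∘ Sq₀ = 1`.
  · rw [hθ' (d + d) (d + d + 1) _ (M.sq_mem_deg hx) (Nat.le_succ _), ← M.sq0_apply hx,
      Finset.sum_range_succ', hθ' d (d + d) x hx (by omega), map_sum]
    have h0 : g 0 (M.sq0 x) = 0 := by
      have : M.pr (M.sq0 x) = 0 := (pr_eq_zero_iff _).2 ⟨x, rfl⟩
      rw [hg]
      simp [this]
    rw [h0, add_zero]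
    refine Finset.sum_congr rfl fun n _ => ?_
    rw [hg, hg, pow_succ ψ, Module.End.mul_apply, ψ_sq0, pow_succ', Module.End.mul_apply]

end GradedSection

end UnstableModule

/-! ### The isomorphism induced by a section -/

section

variable {P : Operad.{u}} {star : P.obj 2} {M : UnstableModule.{v}}

theorem freeUnstable_act_mkQ {n : ℕ} (μ : P.obj n)
    (t : Fin n → (freeAlgebra P M.toGradedSpace).carrier) :
    (freeUnstable P star M).alg.act μ (fun i => (unstIdeal P star M).mkQ (t i)) =
      (unstIdeal P star M).mkQ ((freeAlgebra P M.toGradedSpace).alg.act μ t) :=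
  GradedPAlgebra.quotientAct_mk _ _ (unstIdeal_isUnstableIdeal P star M).isIdeal μ t

/-- In `K(M)` the class of `Sq₀ x` is `star([x], [x])`. -/
theorem freeUnstable.unit_sq {d : ℕ} {x : M.carrier} (hx : x ∈ M.deg d) :
    freeUnstable.unit P star M (M.sq d x) =
      (freeUnstable P star M).alg.act star (fun _ => freeUnstable.unit P star M x) := by
  have hmem : sqFree P M d (freeAlgebra.unit P M.toGradedSpace x) +
      (freeAlgebra P M.toGradedSpace).alg.act star
        (fun _ => freeAlgebra.unit P M.toGradedSpace x) ∈ unstIdeal P star M := by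
    rw [unstIdeal, Submodule.mem_sInf]
    refine fun I hI => hI.2 ⟨d, _, ?_, rfl⟩
    have := Schur.mk_mem_deg P P.one (fun _ => d) (fun _ => x) (V := M.toGradedSpace)
      (fun _ => hx)
    rw [Fin.sum_univ_one] at this
    exact this
  have hsq : sqFree P M d (freeAlgebra.unit P M.toGradedSpace x) =
      freeAlgebra.unit P M.toGradedSpace (M.sq d x) := by
    have := Schur.sq_self_mk P M P.one (fun _ => d) (fun _ => x) (fun _ => hx)
    rw [Fin.sum_univ_one] at this
    exact this
  rw [hsq] at hmem
  refine Eq.trans ?_ (freeUnstable_act_mkQ star _).symm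
  refine (Submodule.Quotient.eq (unstIdeal P star M)).2 ?_
  rwa [sub_eq_add_neg, neg_eq_of_add_eq_zero_left (add_self_F2 _)]

/-- The ideal of relations is killed by every morphism of `P`-algebras that extends a graded
linear map compatible with `Sq₀`. -/
theorem unstIdeal_le_ker_algLift (hcomm : P.IsCommutative star) (hcentral : P.IsCentral star)
    (A : GradedPAlgebra.{u, w} P) (θ : M.carrier →ₗ[F2] A.carrier)
    (hdeg : ∀ d x, x ∈ M.deg d → θ x ∈ A.deg d)
    (hsq : ∀ d x, x ∈ M.deg d → θ (M.sq d x) = A.alg.act star (fun _ => θ x)) :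
    (∀ d t, t ∈ (freeAlgebra P M.toGradedSpace).deg d → Schur.algLift A.alg θ t ∈ A.deg d) ∧
      unstIdeal P star M ≤ LinearMap.ker (Schur.algLift A.alg θ) := by
  have hΘdeg : ∀ d t, t ∈ (freeAlgebra P M.toGradedSpace).deg d →
      Schur.algLift A.alg θ t ∈ A.deg d := by
    intro d t ht
    refine (Submodule.span_le.2 ?_ : Schur.deg P M.toGradedSpace d ≤
      (A.deg d).comap (Schur.algLift A.alg θ)) ht
    rintro _ ⟨n, μ, a, x, hx, rfl, rfl⟩
    rw [SetLike.mem_coe, Submodule.mem_comap, Schur.algLift_mk]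
    exact A.act_mem μ a _ (fun i => hdeg _ _ (hx i))
  -- Both sides are linear in `t`, the right one by commutativity of `star`. On a generator both act
  -- entrywise, by instability on the left and by the interchange law on the right, so `hsq` settles
  -- it.
  have hΘsq : ∀ d t, t ∈ Schur.deg P M.toGradedSpace d →
      Schur.algLift A.alg θ (Schur.sq P M d t) = A.alg.frob hcomm (Schur.algLift A.alg θ t) := by
    intro d t ht
    refine (Submodule.span_le.2 ?_ : Schur.deg P M.toGradedSpace d ≤
      LinearMap.eqLocus (Schur.algLift A.alg θ ∘ₗ Schur.sq P M d)
        (A.alg.frob hcomm ∘ₗ Schur.algLift A.alg θ)) ht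
    rintro _ ⟨n, μ, a, x, hx, rfl, rfl⟩
    rw [SetLike.mem_coe, LinearMap.mem_eqLocus, LinearMap.comp_apply, LinearMap.comp_apply,
      Schur.sq_self_mk P M μ a x hx, Schur.algLift_mk, Schur.algLift_mk, PAlgebra.frob_apply,
      A.alg.act_star_act hcentral]
    simp only [fun i => hsq _ _ (hx i)]
  let Θ : (freeAlgebra P M.toGradedSpace).carrier →ₗ[F2] A.carrier := Schur.algLift A.alg θ
  have hΘact : ∀ {n : ℕ} (μ : P.obj n) (x : Fin n → (freeAlgebra P M.toGradedSpace).carrier),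
      Θ ((freeAlgebra P M.toGradedSpace).alg.act μ x) = A.alg.act μ (fun i => Θ (x i)) :=
    fun μ x => Schur.algLift_act A.alg θ μ x
  refine ⟨hΘdeg, unstIdeal_le_of_isIdeal M hcomm (LinearMap.ker Θ) ?_ ?_ ?_⟩
  · intro n μ x i hx
    rw [LinearMap.mem_ker, hΘact]
    exact MultilinearMap.map_coord_zero _ i (LinearMap.mem_ker.1 hx)
  · intro d x hx
    rw [LinearMap.mem_ker, GradedSpace.map_proj (W := A.toGradedSpace) Θ hΘdeg d x,
      LinearMap.mem_ker.1 hx, map_zero]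
  · rintro _ ⟨d, t, ht, rfl⟩
    have h : Θ (sqFree P M d t) = A.alg.act star (fun _ => Θ t) := hΘsq d t ht
    rw [SetLike.mem_coe, LinearMap.mem_ker, map_add, hΘact, h]
    exact add_self_F2 _

/-- The two algebra morphisms are mutually inverse because they are so on generators: `θ` restricts
to the inclusion of generators along `s`, and `Ψ ∘ θ` is the canonical map `M → K(M)`. -/
theorem exists_iso (hcomm : P.IsCommutative star) (hcentral : P.IsCentral star)
    (hM : M.IsConnected) (hM' : M.IsReduced) (s : M.GradedSection) :
    ∃ e : (freeUnstable P star M).Iso (freeAlgebra P M.omega.susp.toGradedSpace),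
      IsInducedBy P star s e := by
  let A := freeAlgebra P M.omega.susp.toGradedSpace
  let K := freeUnstable P star M
  obtain ⟨θ, hθs, hθsq⟩ := s.exists_extension hM hM'
    (PAlgebra.frob (Schur.algebra P M.omega.susp.carrier) hcomm)
    (Schur.unitHom P M.omega.susp.carrier)
  have hθdeg : ∀ d x, x ∈ M.deg d → θ x ∈ A.deg d := by
    refine s.induction hM (fun d => ?_) (fun d b hb => ?_) (fun d x hx h => ?_)
      (fun d x y hx hy => ?_)
    · rw [map_zero]
      exact Submodule.zero_mem (A.deg d)
    · rw [hθs]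
      have := Schur.mk_mem_deg P P.one (fun _ => d) (fun _ => b)
        (V := M.omega.susp.toGradedSpace) (fun _ => hb)
      rw [Fin.sum_univ_one] at this
      exact this
    · rw [hθsq d x hx]
      have := A.act_mem star (fun _ => d) (fun _ => θ x) (fun _ => h)
      rw [Fin.sum_univ_two] at this
      exact this
    · rw [map_add]
      exact Submodule.add_mem (A.deg d) hx hy
  obtain ⟨hΘdeg, hker⟩ := unstIdeal_le_ker_algLift hcomm hcentral A θ hθdeg hθsq
  let Θ : K.carrier →ₗ[F2] A.carrier := (unstIdeal P star M).liftQ (Schur.algLift A.alg θ) hker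
  have hΘ : ∀ t, Θ ((unstIdeal P star M).mkQ t) = Schur.algLift A.alg θ t := fun t => rfl
  let Ψ : A.carrier →ₗ[F2] K.carrier :=
    (unstIdeal P star M).mkQ ∘ₗ freeAlgebra.map P s.toLinearMap
  have hΨ : ∀ t, Ψ t = (unstIdeal P star M).mkQ (Schur.map P s.toLinearMap t) := fun t => rfl
  have hΘact : ∀ {n : ℕ} (μ : P.obj n) (x : Fin n → K.carrier),
      Θ (K.alg.act μ x) = A.alg.act μ (fun i => Θ (x i)) := by
    intro n μ x
    obtain ⟨y, rfl⟩ := GradedPAlgebra.exists_mk _ x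
    exact (congrArg Θ (freeUnstable_act_mkQ μ y)).trans (Schur.algLift_act A.alg θ μ y)
  have hΨact : ∀ {n : ℕ} (μ : P.obj n) (x : Fin n → A.carrier),
      Ψ (A.alg.act μ x) = K.alg.act μ (fun i => Ψ (x i)) := by
    intro n μ x
    refine (congrArg (unstIdeal P star M).mkQ (Schur.map_act P s.toLinearMap μ x)).trans ?_
    exact (freeUnstable_act_mkQ μ _).symm
  have hΨunit : ∀ b, Ψ (freeAlgebra.unit P M.omega.susp.toGradedSpace b) =
      freeUnstable.unit P star M (s.toLinearMap b) := fun b =>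
    congrArg (unstIdeal P star M).mkQ (Schur.map_mk P s.toLinearMap P.one (fun _ => b))
  have h1 : Θ ∘ₗ Ψ = LinearMap.id := by
    refine Schur.hom_ext A.alg (fun μ t => ?_) (fun μ t => rfl) (fun b => ?_)
    · exact (congrArg Θ (hΨact μ t)).trans (hΘact μ _)
    · refine (congrArg Θ (hΨunit b)).trans ?_
      refine (Schur.algLift_mk A.alg θ P.one (fun _ => s.toLinearMap b)).trans ?_
      rw [A.alg.act_one]
      exact hθs b
  -- Both sides agree on values of `s` and turn `Sq₀` into `star(-, -)`; the values of `s` generate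
  -- `M` under sums and `Sq₀`.
  have hΨθ : ∀ x, Ψ (θ x) = freeUnstable.unit P star M x := by
    have : ∀ d x, x ∈ M.deg d → Ψ (θ x) =
        ((unstIdeal P star M).mkQ ∘ₗ Schur.unitHom P M.carrier) x := by
      refine s.induction hM (fun d => ?_) (fun d b hb => ?_) (fun d x hx h => ?_)
        (fun d x y hx hy => ?_)
      · rw [map_zero, map_zero]
        exact map_zero Ψ
      · rw [hθs]
        exact hΨunit b
      · rw [hθsq d x hx]
        refine (hΨact star (fun _ => θ x)).trans ?_
        rw [h]
        exact (freeUnstable.unit_sq hx).symm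
      · rw [map_add, map_add, ← hx, ← hy]
        exact map_add Ψ _ _
    intro x
    exact LinearMap.congr_fun (M.toGradedSpace.linear_ext (f := Ψ ∘ₗ θ)
      (g := (unstIdeal P star M).mkQ ∘ₗ Schur.unitHom P M.carrier) this) x
  have h2 : Ψ ∘ₗ Θ = LinearMap.id := by
    refine Submodule.linearMap_qext _ ?_
    refine Schur.hom_ext K.alg (fun μ t => ?_) (fun μ t => ?_) (fun x => ?_)
    · refine (congrArg Ψ (Schur.algLift_act A.alg θ μ t)).trans ?_
      exact hΨact μ _
    · exact (freeUnstable_act_mkQ μ t).symm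
    · refine (congrArg Ψ (Schur.algLift_mk A.alg θ P.one (fun _ => x))).trans ?_
      rw [A.alg.act_one]
      exact hΨθ x
  have hΘd : ∀ d x, x ∈ K.deg d → Θ x ∈ A.deg d := by
    rintro d _ ⟨t, ht, rfl⟩
    exact hΘdeg d t ht
  have hΨd : ∀ d x, x ∈ A.deg d → Ψ x ∈ K.deg d := by
    intro d x hx
    exact ⟨_, Schur.map_deg P s.toLinearMap s.map_deg d x hx, rfl⟩
  refine ⟨⟨LinearEquiv.ofLinearMap Θ Ψ h1 h2, hΘact, fun d x => ⟨hΘd d x, fun h => ?_⟩⟩, hΨunit⟩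
  have := hΨd d _ h
  exact (congrArg (· ∈ K.deg d) (LinearMap.congr_fun h2 x)).mp this

/-- The inverse of such an isomorphism is a morphism out of a free algebra, hence determined by its
values on generators. -/
theorem IsInducedBy.unique {s : M.GradedSection}
    {e e' : (freeUnstable P star M).Iso (freeAlgebra P M.omega.susp.toGradedSpace)}
    (he : IsInducedBy P star s e) (he' : IsInducedBy P star s e') : e = e' := by
  have hsymm : ∀ (e : (freeUnstable P star M).Iso (freeAlgebra P M.omega.susp.toGradedSpace))
      {n : ℕ} (μ : P.obj n) (t : Fin n → (freeAlgebra P M.omega.susp.toGradedSpace).carrier),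
      e.toLinearEquiv.symm ((freeAlgebra P M.omega.susp.toGradedSpace).alg.act μ t) =
        (freeUnstable P star M).alg.act μ (fun i => e.toLinearEquiv.symm (t i)) := by
    intro e n μ t
    rw [LinearEquiv.symm_apply_eq, e.map_act]
    simp only [LinearEquiv.apply_symm_apply]
  have h : e.toLinearEquiv.symm.toLinearMap = e'.toLinearEquiv.symm.toLinearMap :=
    Schur.hom_ext (freeUnstable P star M).alg (hsymm e) (hsymm e')
      (fun b => (he b).trans (he' b).symm)
  have h' : e.toLinearEquiv = e'.toLinearEquiv := by
    rw [← LinearEquiv.symm_symm e.toLinearEquiv, LinearEquiv.toLinearMap_injective h]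
    rfl
  cases e
  cases e'
  simp only at h'
  subst h'
  rfl

end

/-! ### Squares of generators in free algebras -/

section

variable {P : Operad.{u}} {star : P.obj 2}

/-- If `star` is not a symmetrization, then `star(c, c)` is non-zero in `S(P, V)` for all non-zero
generators `c`. -/
theorem Schur.mk_star_ne_zero (hstar : ∀ μ : P.obj 2, star ≠ μ + P.relabel (Equiv.swap 0 1) μ)
    {V : Type v} [AddCommGroup V] [Module F2 V] {c : V} (hc : c ≠ 0) :
    Schur.mk star (fun _ => c) ≠ 0 := by
  obtain ⟨l, hl⟩ : ∃ l : V →ₗ[F2] F2, l c ≠ 0 := by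
    by_contra! h
    exact hc ((Module.forall_dual_apply_eq_zero_iff F2 c).1 h)
  have hF2 : ∀ a : F2, a ≠ 0 → a = 1 := by decide
  replace hl : l c = 1 := hF2 _ hl
  -- `P.obj 2 ⧸ D` is the space of coinvariants `P(2)_{Σ₂}`, in which `star` is non-zero by `hstar`.
  let D : Submodule F2 (P.obj 2) := LinearMap.range (LinearMap.id + P.relabel (Equiv.swap 0 1))
  have hD : ∀ (σ : Fin 2 ≃ Fin 2) (μ : P.obj 2), D.mkQ (P.relabel σ μ) = D.mkQ μ := by
    intro σ μ
    have hσ : σ = Equiv.refl _ ∨ σ = Equiv.swap 0 1 := by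
      revert σ
      decide
    rcases hσ with rfl | rfl
    · rw [P.relabel_refl]
    · refine (Submodule.Quotient.eq D).2 ⟨μ, ?_⟩
      rw [sub_eq_add_neg, neg_eq_of_add_eq_zero_left (add_self_F2 _), add_comm]
      rfl
  -- The functional `(μ; x, y) ↦ l x · l y · [μ]`, zero on all other arities, sends `(star; c, c)`
  -- to `[star]`. The relabelling by `finCongr` only transports the variable arity to 2.
  obtain ⟨L, hL⟩ := Schur.exists_lift (P := P) (V := V) (Z := P.obj 2 ⧸ D)
    (fun n μ x => if h : n = 2 then (∏ i, l (x i)) • D.mkQ (P.relabel (finCongr h) μ) else 0)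
    (fun n μ ν x => by split_ifs <;> simp)
    (fun n μ x i v w => by
      split_ifs
      · have := ((MultilinearMap.mkPiAlgebra F2 (Fin n) F2).compLinearMap
          (fun _ => l)).map_update_add x i v w
        simp only [MultilinearMap.compLinearMap_apply, MultilinearMap.mkPiAlgebra_apply] at this
        rw [this, add_smul]
      · simp)
    (fun n σ μ x => by
      split_ifs with h
      · subst h
        rw [hD, hD, hD, Equiv.prod_comp σ (fun i => l (x i))]
      · rfl)
  intro h
  have h2 := hL 2 star (fun _ => c)
  rw [h, map_zero, dif_pos rfl, hD] at h2
  simp only [hl, Finset.prod_const_one, one_smul] at h2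
  obtain ⟨μ, hμ⟩ := (Submodule.Quotient.mk_eq_zero D).1 h2.symm
  exact hstar μ hμ.symm

/-- In `K(M)` the class of `Sq₀ x` is non-zero for every non-zero `x` of odd degree. -/
theorem freeUnstable.unit_sq_ne_zero (hcomm : P.IsCommutative star) (hcentral : P.IsCentral star)
    (hstar : ∀ μ : P.obj 2, star ≠ μ + P.relabel (Equiv.swap 0 1) μ)
    {M : UnstableModule.{v}} (hM : M.IsConnected) (hM' : M.IsReduced) {d : ℕ} (hd : Odd d)
    {x : M.carrier} (hx : x ∈ M.deg d) (hx0 : x ≠ 0) :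
    freeUnstable.unit P star M (M.sq d x) ≠ 0 := by
  -- `Im Sq₀` is concentrated in even degrees. In odd degree `d` the map `pr` is therefore
  -- injective, every section returns `x` from `pr x`, and `[x]` corresponds to a non-zero
  -- generator.
  have hodd : ∀ y ∈ M.deg d, y ∈ LinearMap.range M.sq0 → y = 0 := by
    rintro _ hy ⟨z, rfl⟩
    rw [← M.isProjFamily.self d _ hy]
    refine M.proj_odd_sq0 d (fun e he => ?_) z
    exact (Nat.not_even_iff_odd.2 hd) ⟨e, he⟩
  obtain ⟨s⟩ := M.nonempty_gradedSection
  obtain ⟨e, he⟩ := exists_iso hcomm hcentral hM hM' s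
  have hs : s.toLinearMap (M.pr x) = x :=
    (sub_eq_zero.1 (hodd _ (Submodule.sub_mem _ hx (s.map_pr_mem_deg hx)) (s.sub_mem_range x))).symm
  have hpr : M.pr x ≠ 0 := fun h => hx0 (hodd x hx ((UnstableModule.pr_eq_zero_iff x).1 h))
  have hex : e.toLinearEquiv (freeUnstable.unit P star M x) =
      freeAlgebra.unit P M.omega.susp.toGradedSpace (M.pr x) := by
    rw [← LinearEquiv.eq_symm_apply, he, hs]
  intro h
  refine Schur.mk_star_ne_zero hstar hpr ?_
  rw [← Schur.actMap_unitHom]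
  have h2 := congrArg e.toLinearEquiv h
  rw [freeUnstable.unit_sq hx, e.map_act, hex, map_zero] at h2
  exact h2

end

/-! ### Unstable modules spanned by classes in degrees `2 ^ k` -/

theorem UnstableModule.sq_comm_act {M : UnstableModule.{v}} {N : UnstableModule.{w}}
    (f : M.carrier →ₗ[F2] N.carrier) (h : ∀ i x, f (M.sq i x) = N.sq i (f x)) (a : Steenrod) :
    ∀ x, f (M.act a x) = N.act a (f x) := by
  induction a using Steenrod.induction with
  | scalar r => intro x; simp
  | sq i => exact h i
  | mul a b ha hb => intro x; rw [map_mul, map_mul, Module.End.mul_apply, ha, hb]; rfl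
  | add a b ha hb => intro x; rw [map_add, map_add, LinearMap.add_apply, map_add, ha, hb]; rfl

/-- For `i < 2 ^ m` the number `2 ^ m - 1 - i` is the binary complement of `i`, so some digit of `i`
is 1 over a digit 0 and Lucas' theorem gives an even coefficient. The induction on `m` peels off the
last digit; for larger `i` the truncated subtraction makes the coefficient zero. -/
theorem even_choose_two_pow_sub (m i : ℕ) (hi : 0 < i) :
    ((Nat.choose (2 ^ m - 1 - i) i : ℕ) : F2) = 0 := by
  rw [ZMod.natCast_eq_zero_iff]
  induction m generalizing i with
  | zero => rw [Nat.choose_eq_zero_of_lt (by omega)]; simp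
  | succ m ih =>
    by_cases hlt : 2 ^ (m + 1) - 1 - i < i
    · rw [Nat.choose_eq_zero_of_lt hlt]; simp
    have h := Choose.choose_modEq_choose_mod_mul_choose_div_nat (n := 2 ^ (m + 1) - 1 - i) (k := i)
      (p := 2)
    rw [← Nat.modEq_zero_iff_dvd]
    refine h.trans ?_
    rw [Nat.modEq_zero_iff_dvd]
    have hp : 2 ^ (m + 1) = 2 * 2 ^ m := pow_succ' 2 m
    rcases Nat.even_or_odd' i with ⟨j, rfl | rfl⟩
    · have e1 : (2 ^ (m + 1) - 1 - 2 * j) / 2 = 2 ^ m - 1 - j := by omega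
      have e2 : 2 * j / 2 = j := by omega
      rw [e1, e2]
      exact Dvd.dvd.mul_left (ih j (by omega)) _
    · have e1 : (2 ^ (m + 1) - 1 - (2 * j + 1)) % 2 = 0 := by omega
      have e2 : (2 * j + 1) % 2 = 1 := by omega
      rw [e1, e2]
      simp

section

variable {ι : Type v} (k : ι → ℕ) (σ : ι → ι)

/-- The operation `Sq^i` on the span of classes `a` of degree `2 ^ k a` with `Sq₀ a = σ a` and no
other non-trivial squares. -/
def powerSq (i : ℕ) : (ι →₀ F2) →ₗ[F2] (ι →₀ F2) :=
  Finsupp.linearCombination F2 (fun a => if i = 0 then Finsupp.single a 1 else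
    if i = 2 ^ k a then Finsupp.single (σ a) 1 else 0)

theorem powerSq_single (i : ℕ) (a : ι) : powerSq k σ i (Finsupp.single a 1) =
    if i = 0 then Finsupp.single a 1 else if i = 2 ^ k a then Finsupp.single (σ a) 1 else 0 := by
  simp [powerSq]

theorem powerSq_zero : powerSq k σ 0 = 1 := by
  refine Finsupp.lhom_ext' fun a => LinearMap.ext_ring ?_
  simp [powerSq_single]

variable {k σ}

/-- Every term vanishes separately. A composite of two positive squares is non-zero on `a` only if
they are `Sq^r` with `r = 2 ^ k a` followed by `Sq^{2r}`, and admissibility considerations exclude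
this on both sides. What remains is `Sq^{i+j}`, whose coefficient has to be even. -/
theorem powerSq_adem (hσ : ∀ a, k (σ a) = k a + 1) (i j : ℕ) (hi : 0 < i) (hij : i < 2 * j) :
    powerSq k σ i * powerSq k σ j = ∑ l ∈ Finset.range (i / 2 + 1),
      ((Nat.choose (j - l - 1) (i - 2 * l) : ℕ) : F2) •
        (powerSq k σ (i + j - l) * powerSq k σ l) := by
  refine Finsupp.lhom_ext' fun a => LinearMap.ext_ring ?_
  simp only [LinearMap.comp_apply, Finsupp.lsingle_apply, Module.End.mul_apply,
    LinearMap.sum_apply, LinearMap.smul_apply]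
  have hp : 2 ^ (k a + 1) = 2 * 2 ^ k a := pow_succ' 2 (k a)
  have hpos : 0 < 2 ^ k a := by positivity
  have hL : powerSq k σ i (powerSq k σ j (Finsupp.single a 1)) = 0 := by
    rw [powerSq_single, if_neg (by omega)]
    split_ifs with h
    · rw [powerSq_single, if_neg (by omega), hσ, if_neg (by omega)]
    · rw [map_zero]
  rw [hL]
  symm
  refine Finset.sum_eq_zero fun l hl => ?_
  rw [Finset.mem_range] at hl
  rcases Nat.eq_zero_or_pos l with rfl | hl0
  · rw [powerSq_zero, Module.End.one_apply, powerSq_single, if_neg (by omega)]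
    split_ifs with h
    -- Here `i + j = 2 ^ k a`, so the coefficient is the binomial of `2 ^ k a - 1 - i` over `i`.
    · have e : j - 0 - 1 = 2 ^ k a - 1 - i := by omega
      rw [e, Nat.mul_zero, Nat.sub_zero, even_choose_two_pow_sub _ _ hi, zero_smul]
    · rw [smul_zero]
  · rw [powerSq_single k σ l, if_neg (by omega)]
    split_ifs with h
    · rw [powerSq_single, if_neg (by omega), hσ, if_neg (by omega), smul_zero]
    · rw [map_zero, smul_zero]

variable (k) in
theorem power_isProjFamily : IsProjFamily (fun d => Finsupp.supported F2 F2 {a | 2 ^ k a = d})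
    (fun d => Finsupp.linearCombination F2
      (fun a => if 2 ^ k a = d then Finsupp.single a 1 else 0)) := by
  refine ⟨fun d x hx => ?_, fun d e x hde hx => ?_, ?_⟩
  · rw [Finsupp.supported_eq_span_single] at hx
    refine (Submodule.span_le.2 ?_ : _ ≤ LinearMap.eqLocus _ LinearMap.id) hx
    rintro _ ⟨a, ha, rfl⟩
    rw [Set.mem_ofPred_eq] at ha
    simp [ha]
  · rw [Finsupp.supported_eq_span_single] at hx
    refine (Submodule.span_le.2 ?_ : _ ≤ LinearMap.ker _) hx
    rintro _ ⟨a, ha, rfl⟩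
    rw [Set.mem_ofPred_eq] at ha
    simp [ha, hde]
  · rw [eq_top_iff]
    intro x _
    induction x using Finsupp.induction_linear with
    | zero => exact Submodule.zero_mem _
    | add x y hx hy => exact Submodule.add_mem _ (hx trivial) (hy trivial)
    | single a r =>
      exact (le_iSup (fun d => Finsupp.supported F2 F2 {a | 2 ^ k a = d}) (2 ^ k a))
        (Finsupp.single_mem_supported F2 r rfl)

/-- The action of the Steenrod algebra on the span of classes of degree `2 ^ k a`. -/
def powerAct (hσ : ∀ a, k (σ a) = k a + 1) : Steenrod →ₐ[F2] Module.End F2 (ι →₀ F2) :=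
  RingQuot.liftAlgHom F2 ⟨FreeAlgebra.lift F2 (powerSq k σ), by
    rintro _ _ (_ | ⟨i, j, hi, hij⟩)
    · rw [FreeAlgebra.lift_ι_apply, map_one, powerSq_zero]
    · simp only [map_mul, map_sum, map_smul, FreeAlgebra.lift_ι_apply]
      exact powerSq_adem hσ i j hi hij⟩

theorem powerAct_Sq (hσ : ∀ a, k (σ a) = k a + 1) (i : ℕ) :
    powerAct hσ (Sq i) = powerSq k σ i := by
  rw [powerAct, Sq, RingQuot.liftAlgHom_mkAlgHom_apply, FreeAlgebra.lift_ι_apply]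

variable (k σ) in
/-- The unstable module with a basis of classes `a` of degree `2 ^ k a` and `Sq₀ a = σ a`. -/
def powerModule (hσ : ∀ a, k (σ a) = k a + 1) : UnstableModule.{v} where
  carrier := ι →₀ F2
  deg d := Finsupp.supported F2 F2 {a | 2 ^ k a = d}
  isInternal := (power_isProjFamily k).isInternal
  act := powerAct hσ
  sq_mem i d x hx := by
    rw [powerAct_Sq]
    rw [Finsupp.supported_eq_span_single] at hx
    refine (Submodule.span_le.2 ?_ : _ ≤ (Finsupp.supported F2 F2 _).comap (powerSq k σ i)) hx
    rintro _ ⟨a, ha, rfl⟩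
    rw [Set.mem_ofPred_eq] at ha
    rw [SetLike.mem_coe, Submodule.mem_comap, powerSq_single]
    split_ifs with h h'
    · exact Finsupp.single_mem_supported F2 1 (by simp [ha, h])
    · refine Finsupp.single_mem_supported F2 1 ?_
      rw [Set.mem_ofPred_eq, hσ, pow_succ, mul_two, h', ha]
    · exact Submodule.zero_mem _
  unstable i d x hx hi := by
    rw [powerAct_Sq]
    rw [Finsupp.supported_eq_span_single] at hx
    refine (Submodule.span_le.2 ?_ : _ ≤ LinearMap.ker (powerSq k σ i)) hx
    rintro _ ⟨a, ha, rfl⟩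
    rw [Set.mem_ofPred_eq] at ha
    rw [SetLike.mem_coe, LinearMap.mem_ker, powerSq_single, if_neg (by omega), if_neg (by omega)]

theorem powerModule_sq (hσ : ∀ a, k (σ a) = k a + 1) (i : ℕ) :
    (powerModule k σ hσ).sq i = powerSq k σ i :=
  powerAct_Sq hσ i

theorem powerModule_isConnected (hσ : ∀ a, k (σ a) = k a + 1) :
    (powerModule k σ hσ).IsConnected := by
  have : {a | 2 ^ k a = 0} = (∅ : Set ι) := by
    ext a
    simp
  change Finsupp.supported F2 F2 {a | 2 ^ k a = 0} = ⊥
  rw [this, Finsupp.supported_empty]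

/-- On the part of degree `d` the operation `Sq^d` is the linearization of the injective map `σ` of
basis elements. -/
theorem powerModule_isReduced (hσ : ∀ a, k (σ a) = k a + 1) (hinj : Function.Injective σ) :
    (powerModule k σ hσ).IsReduced := by
  intro d x hx h
  rw [powerModule_sq] at h
  have key : powerSq k σ d x = Finsupp.lmapDomain F2 F2 σ x := by
    have hx' : x ∈ Finsupp.supported F2 F2 {a | 2 ^ k a = d} := hx
    rw [Finsupp.supported_eq_span_single] at hx'
    refine (Submodule.span_le.2 ?_ : _ ≤ LinearMap.eqLocus (powerSq k σ d)
      (Finsupp.lmapDomain F2 F2 σ)) hx'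
    rintro _ ⟨a, rfl, rfl⟩
    have hpos : 2 ^ k a ≠ 0 := by positivity
    rw [SetLike.mem_coe, LinearMap.mem_eqLocus, powerSq_single, if_neg hpos, if_pos rfl]
    simp
  exact Finsupp.mapDomain_injective hinj ((key.symm.trans h).trans Finsupp.mapDomain_zero.symm)

end

/-! ### Two towers -/

/-- The exponent of the degree of the class `(b, n)`: it is `n + 1` if `b` is true and `n`
otherwise. -/
def towerExp (a : ULift.{v} (Bool × ℕ)) : ℕ := a.down.2 + cond a.down.1 1 0

/-- The class `Sq₀ (b, n) = (b, n + 1)`. -/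
def towerSucc (a : ULift.{v} (Bool × ℕ)) : ULift.{v} (Bool × ℕ) := ⟨(a.down.1, a.down.2 + 1)⟩

theorem towerExp_succ (a : ULift.{v} (Bool × ℕ)) : towerExp (towerSucc a) = towerExp a + 1 := by
  simp only [towerExp, towerSucc]
  omega

theorem towerSucc_injective : Function.Injective towerSucc.{v} := by
  rintro ⟨b, n⟩ ⟨b', n'⟩ h
  simpa [towerSucc] using h

/-- The direct sum of a tower starting in degree `1` and a tower starting in degree `2`. -/
def twoTowers : UnstableModule.{v} := powerModule towerExp towerSucc towerExp_succ

theorem twoTowers_isConnected : twoTowers.{v}.IsConnected := powerModule_isConnected towerExp_succ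

theorem twoTowers_isReduced : twoTowers.{v}.IsReduced :=
  powerModule_isReduced towerExp_succ towerSucc_injective

/-- The basis element `(b, n)`, of degree `2 ^ n` or `2 ^ (n + 1)`. -/
def towerClass (b : Bool) (n : ℕ) : twoTowers.{v}.carrier :=
  (Finsupp.single ⟨(b, n)⟩ 1 : ULift.{v} (Bool × ℕ) →₀ F2)

theorem towerClass_mem (b : Bool) (n : ℕ) :
    towerClass.{v} b n ∈ twoTowers.{v}.deg (2 ^ (n + cond b 1 0)) :=
  Finsupp.single_mem_supported F2 1 rfl

theorem sq_towerClass (i : ℕ) (b : Bool) (n : ℕ) : twoTowers.{v}.sq i (towerClass b n) =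
    if i = 0 then towerClass b n else
      if i = 2 ^ (n + cond b 1 0) then towerClass b (n + 1) else 0 :=
  (LinearMap.congr_fun (powerModule_sq towerExp_succ i) _).trans (powerSq_single _ _ _ _)

theorem sq_towerClass_self (b : Bool) (n : ℕ) :
    twoTowers.{v}.sq (2 ^ (n + cond b 1 0)) (towerClass b n) = towerClass b (n + 1) := by
  rw [sq_towerClass, if_neg (by positivity), if_pos rfl]

theorem twoTowers_linear_ext {Z : Type w} [AddCommGroup Z] [Module F2 Z]
    {f g : twoTowers.{v}.carrier →ₗ[F2] Z}
    (h : ∀ b n, f (towerClass b n) = g (towerClass b n)) : f = g :=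
  Finsupp.lhom_ext' (α := ULift.{v} (Bool × ℕ)) (M := F2) fun a =>
    LinearMap.ext_ring (h a.down.1 a.down.2)

/-- The linear map `(true, n) ↦ (false, n + 1)`, `(false, n) ↦ 0`. -/
def towerShift : twoTowers.{v}.carrier →ₗ[F2] twoTowers.{v}.carrier :=
  Finsupp.linearCombination F2 (α := ULift.{v} (Bool × ℕ)) (M := twoTowers.{v}.carrier)
    (fun a => cond a.down.1 (towerClass false (a.down.2 + 1)) 0)

theorem towerShift_class (b : Bool) (n : ℕ) :
    towerShift.{v} (towerClass b n) = cond b (towerClass false (n + 1)) 0 :=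
  (Finsupp.linearCombination_single F2 _ _).trans (one_smul _ _)

/-- The morphism `(true, n) ↦ (false, n + 1)`, `(false, n) ↦ 0` of unstable modules. -/
def towerHom : twoTowers.{v}.Hom twoTowers.{v} where
  toLinearMap := towerShift
  map_act := by
    refine UnstableModule.sq_comm_act towerShift fun i => LinearMap.congr_fun
      (f := towerShift ∘ₗ twoTowers.sq i) (g := twoTowers.sq i ∘ₗ towerShift) ?_
    refine twoTowers_linear_ext fun b n => ?_
    rw [LinearMap.comp_apply, LinearMap.comp_apply, sq_towerClass, towerShift_class]
    cases b with
    | false => split_ifs <;> simp [towerShift_class]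
    | true =>
      -- `(true, n)` and `(false, n + 1)` both have degree `2 ^ (n + 1)`, so the same square moves
      -- each of them up its tower.
      simp only [cond_true, sq_towerClass, cond_false, add_zero]
      split_ifs <;> simp [towerShift_class]
  map_deg d x hx := by
    have hx' : x ∈ Finsupp.supported F2 F2 {a : ULift.{v} (Bool × ℕ) | 2 ^ towerExp a = d} := hx
    rw [Finsupp.supported_eq_span_single] at hx'
    refine (Submodule.span_le.2 ?_ : _ ≤ (twoTowers.deg d).comap towerShift) hx'
    rintro _ ⟨⟨b, n⟩, rfl, rfl⟩
    refine (congrArg (· ∈ twoTowers.deg _) (towerShift_class b n)).mpr ?_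
    cases b with
    | false => exact Submodule.zero_mem _
    | true => exact towerClass_mem false (n + 1)

/-- The image of `towerHom` lies in `Im Sq₀`, because `(false, n + 1) = Sq₀ (false, n)`. -/
theorem towerHom_omega : towerHom.{v}.omega.susp.toLinearMap = 0 := by
  have h : twoTowers.pr ∘ₗ towerShift.{v} = 0 := by
    refine twoTowers_linear_ext fun b n => ?_
    rw [LinearMap.comp_apply, towerShift_class]
    cases b with
    | false => exact map_zero twoTowers.pr
    | true =>
      rw [cond_true, ← sq_towerClass_self]
      exact UnstableModule.pr_sq _ _ (towerClass_mem false n)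
  exact Submodule.linearMap_qext _ h

/-! ### Failure of naturality and dependence on the section -/

section

variable {P : Operad.{u}} {star : P.obj 2}

/-- `S(P, 0)` need not be zero: operations of arity zero survive, but only in degree 0. This is why
positive degree is required. -/
theorem freeAlgebra.map_zero_of_pos {V : GradedSpace.{v}} {W : GradedSpace.{w}} {d : ℕ}
    (hd : 0 < d) {t : (freeAlgebra P V).carrier} (ht : t ∈ (freeAlgebra P V).deg d) :
    freeAlgebra.map P (0 : V.carrier →ₗ[F2] W.carrier) t = 0 := by
  refine (Submodule.span_le.2 ?_ : Schur.deg P V d ≤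
    LinearMap.ker (Schur.map P (0 : V.carrier →ₗ[F2] W.carrier))) ht
  rintro _ ⟨n, μ, a, x, hx, rfl, rfl⟩
  rw [SetLike.mem_coe, LinearMap.mem_ker, Schur.map_mk]
  cases n with
  | zero => simp at hd
  | succ n => exact Schur.mk_zero_of P μ _ 0 rfl

theorem freeUnstable.unit_mem_deg {M : UnstableModule.{v}} {d : ℕ} {x : M.carrier}
    (hx : x ∈ M.deg d) : freeUnstable.unit P star M x ∈ (freeUnstable P star M).deg d := by
  have := Schur.mk_mem_deg P P.one (fun _ => d) (fun _ => x) (V := M.toGradedSpace) (fun _ => hx)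
  rw [Fin.sum_univ_one] at this
  exact ⟨_, this, rfl⟩

theorem freeUnstable.map_unit {M : UnstableModule.{v}} {N : UnstableModule.{w}} (f : M.Hom N)
    (x : M.carrier) : freeUnstable.map P star f (freeUnstable.unit P star M x) =
      freeUnstable.unit P star N (f.toLinearMap x) :=
  congrArg (unstIdeal P star N).mkQ (Schur.map_mk P f.toLinearMap P.one (fun _ => x))

theorem freeUnstable.unit_add {M : UnstableModule.{v}} (x y : M.carrier) :
    freeUnstable.unit P star M (x + y) =
      freeUnstable.unit P star M x + freeUnstable.unit P star M y :=
  map_add ((unstIdeal P star M).mkQ ∘ₗ Schur.unitHom P M.carrier) x y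

theorem unit_towerClass_ne_zero (hcomm : P.IsCommutative star) (hcentral : P.IsCentral star)
    (hstar : ∀ μ : P.obj 2, star ≠ μ + P.relabel (Equiv.swap 0 1) μ) :
    freeUnstable.unit P star twoTowers.{v} (towerClass false 1) ≠ 0 := by
  have hne : towerClass.{v} false 0 ≠ 0 := Finsupp.single_ne_zero.2 one_ne_zero
  rw [show towerClass.{v} false 1 = twoTowers.sq 1 (towerClass false 0) from
    (sq_towerClass_self false 0).symm]
  exact freeUnstable.unit_sq_ne_zero hcomm hcentral hstar twoTowers_isConnected
    twoTowers_isReduced odd_one (towerClass_mem false 0) hne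

/-- No isomorphisms `K(M) ≅ S(P, ΣΩM)` for the module `twoTowers` are compatible with the maps
induced by `towerHom`. -/
theorem not_natural (hcomm : P.IsCommutative star) (hcentral : P.IsCentral star)
    (hstar : ∀ μ : P.obj 2, star ≠ μ + P.relabel (Equiv.swap 0 1) μ)
    (e e' : (freeUnstable P star twoTowers.{v}).Iso
      (freeAlgebra P twoTowers.{v}.omega.susp.toGradedSpace)) :
    ¬ ∀ x, e'.toLinearEquiv (freeUnstable.map P star towerHom x) =
      freeAlgebra.map P towerHom.omega.susp.toLinearMap (e.toLinearEquiv x) := by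
  intro h
  refine unit_towerClass_ne_zero hcomm hcentral hstar ?_
  -- The bottom class `(true, 0)` has degree 2, so the map induced by zero on `S(P, ΣΩM)` kills its
  -- image. On the other side it goes to the class of `(false, 1) = Sq₀ (false, 0)`, which is
  -- non-zero.
  have h1 := h (freeUnstable.unit P star twoTowers (towerClass true 0))
  rw [towerHom_omega, freeAlgebra.map_zero_of_pos (d := 2) two_pos
    ((e.map_deg _ _).1 (freeUnstable.unit_mem_deg (towerClass_mem true 0))),
    freeUnstable.map_unit, LinearEquiv.map_eq_zero_iff] at h1
  rw [← h1]
  exact congrArg _ (towerShift_class true 0).symm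

/-- The coordinate of the class `(true, 0)`, which does not depend on the image of `Sq₀`. -/
theorem exists_coordinate : ∃ l : twoTowers.{v}.omega.susp.carrier →ₗ[F2] F2,
    l (twoTowers.pr (towerClass true 0)) = 1 ∧
      ∀ d b, b ∈ twoTowers.{v}.omega.susp.deg d → d ≠ 2 → l b = 0 := by
  let l₀ : twoTowers.{v}.carrier →ₗ[F2] F2 :=
    Finsupp.lapply (M := F2) (⟨(true, 0)⟩ : ULift.{v} (Bool × ℕ))
  have hl₀ : ∀ b n, l₀ (towerClass b n) = if b = true ∧ n = 0 then 1 else 0 := by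
    intro b n
    refine (Finsupp.single_apply (M := F2)).trans ?_
    simp
  have hdeg : ∀ d x, x ∈ twoTowers.{v}.deg d → d ≠ 2 → l₀ x = 0 := by
    intro d x hx hd
    have hx' : x ∈ Finsupp.supported F2 F2 {a : ULift.{v} (Bool × ℕ) | 2 ^ towerExp a = d} := hx
    refine (Finsupp.mem_supported' F2 _).1 hx' _ fun h => hd ?_
    exact h.symm
  have hker : twoTowers.{v}.imSq0 ≤ LinearMap.ker l₀ := by
    rw [← UnstableModule.range_sq0]
    have : l₀ ∘ₗ twoTowers.sq0 = 0 := by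
      refine twoTowers_linear_ext fun b n => ?_
      rw [LinearMap.comp_apply, UnstableModule.sq0_apply _ (towerClass_mem b n),
        sq_towerClass_self, hl₀]
      simp
    rintro _ ⟨x, rfl⟩
    exact LinearMap.congr_fun this x
  refine ⟨twoTowers.imSq0.liftQ l₀ hker, ?_, ?_⟩
  · exact (hl₀ true 0).trans (by simp)
  · intro d b hb hd
    cases d with
    | zero =>
      have hb0 : b = 0 := hb
      rw [hb0]
      exact map_zero (twoTowers.imSq0.liftQ l₀ hker)
    | succ d =>
      obtain ⟨x, hx, rfl⟩ := hb
      exact hdeg _ x hx hd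

/-- Sections may differ by elements of `Im Sq₀`. The class of such an element in `K(M)` is a value
of `star` on the diagonal, which is non-zero here. -/
theorem exists_two_sections (hcomm : P.IsCommutative star) (hcentral : P.IsCentral star)
    (hstar : ∀ μ : P.obj 2, star ≠ μ + P.relabel (Equiv.swap 0 1) μ) :
    ∃ (s s' : twoTowers.{v}.GradedSection)
      (e e' : (freeUnstable P star twoTowers.{v}).Iso
        (freeAlgebra P twoTowers.{v}.omega.susp.toGradedSpace)),
      IsInducedBy P star s e ∧ IsInducedBy P star s' e' ∧ e ≠ e' := by
  obtain ⟨s⟩ := twoTowers.{v}.nonempty_gradedSection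
  obtain ⟨l, hl1, hl⟩ := exists_coordinate.{v}
  -- `s'` alters `s` only in degree 2, where `(true, 0)` and the element `(false, 1)` of `Im Sq₀`
  -- coexist.
  let s' : twoTowers.{v}.GradedSection :=
    { toLinearMap := s.toLinearMap + l.smulRight (towerClass false 1)
      map_deg := fun d b hb => by
        rw [LinearMap.add_apply]
        refine Submodule.add_mem _ (s.map_deg d b hb) ?_
        rw [LinearMap.smulRight_apply]
        by_cases hd : d = 2
        · subst hd
          exact Submodule.smul_mem _ _ (towerClass_mem false 1)
        · rw [hl d b hb hd, zero_smul]
          exact Submodule.zero_mem _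
      pr_apply := fun b => by
        have h : twoTowers.{v}.pr (towerClass false 1) = 0 := by
          rw [show towerClass.{v} false 1 = twoTowers.sq 1 (towerClass false 0) from
            (sq_towerClass_self false 0).symm]
          exact UnstableModule.pr_sq _ _ (towerClass_mem false 0)
        rw [LinearMap.add_apply, map_add, s.pr_apply, LinearMap.smulRight_apply, map_smul, h,
          smul_zero, add_zero] }
  obtain ⟨e, he⟩ := exists_iso hcomm hcentral twoTowers_isConnected twoTowers_isReduced s
  obtain ⟨e', he'⟩ := exists_iso hcomm hcentral twoTowers_isConnected twoTowers_isReduced s'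
  refine ⟨s, s', e, e', he, he', ?_⟩
  rintro rfl
  refine unit_towerClass_ne_zero hcomm hcentral hstar ?_
  -- A common isomorphism would give `[s' b] = [s b]` for `b = pr (true, 0)`, hence `[(false, 1)] =
  -- 0`.
  have h := (he' (twoTowers.pr (towerClass true 0))).symm.trans (he _)
  have hs' : s'.toLinearMap (twoTowers.pr (towerClass true 0)) =
      s.toLinearMap (twoTowers.pr (towerClass true 0)) + towerClass false 1 := by
    change s.toLinearMap _ + l _ • towerClass false 1 = _
    rw [hl1, one_smul]
  rw [hs', freeUnstable.unit_add] at h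
  exact add_eq_left.1 h

end

end UnstableOperad

end

theorem mainTheorem1 (P : Operad.{u}) (star : P.obj 2) (hcomm : P.IsCommutative star)
    (hcentral : P.IsCentral star) :
    -- every connected reduced unstable module admits graded sections, and each of them induces
    -- an isomorphism of graded `P`-algebras
    (∀ M : UnstableModule.{v}, M.IsConnected → M.IsReduced →
      Nonempty ((freeUnstable P star M).Iso (freeAlgebra P M.omega.susp.toGradedSpace)) ∧
      Nonempty M.GradedSection ∧
      ∀ s : M.GradedSection,
        ∃! e : (freeUnstable P star M).Iso (freeAlgebra P M.omega.susp.toGradedSpace),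
          IsInducedBy P star s e) ∧
    -- if `star` is not the symmetrization of a binary operation, equivalently if it does not
    -- vanish on the diagonal of free algebras, then there is no natural isomorphism at all, and
    -- the induced isomorphism depends on the section
    ((∀ μ : P.obj 2, star ≠ μ + P.relabel (Equiv.swap 0 1) μ) →
      (¬ ∃ e : ∀ M : UnstableModule.{v}, M.IsConnected → M.IsReduced →
          (freeUnstable P star M).Iso (freeAlgebra P M.omega.susp.toGradedSpace),
        ∀ (M N : UnstableModule.{v}) (hM : M.IsConnected) (hM' : M.IsReduced)
          (hN : N.IsConnected) (hN' : N.IsReduced) (f : M.Hom N)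
          (x : (freeUnstable P star M).carrier),
          (e N hN hN').toLinearEquiv (freeUnstable.map P star f x) =
            freeAlgebra.map P f.omega.susp.toLinearMap ((e M hM hM').toLinearEquiv x)) ∧
      ∃ M : UnstableModule.{v}, M.IsConnected ∧ M.IsReduced ∧
        ∃ (s s' : M.GradedSection)
          (e e' : (freeUnstable P star M).Iso (freeAlgebra P M.omega.susp.toGradedSpace)),
          IsInducedBy P star s e ∧ IsInducedBy P star s' e' ∧ e ≠ e') := by
  refine ⟨fun M hM hM' => ?_, fun hstar => ⟨?_, twoTowers, twoTowers_isConnected,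
    twoTowers_isReduced, exists_two_sections hcomm hcentral hstar⟩⟩
  · have h := fun s => exists_iso hcomm hcentral hM hM' s
    obtain ⟨s⟩ := M.nonempty_gradedSection
    refine ⟨⟨(h s).choose⟩, ⟨s⟩, fun s => ?_⟩
    obtain ⟨e, he⟩ := h s
    exact ⟨e, he, fun e' he' => he'.unique he⟩
  · rintro ⟨e, he⟩
    exact not_natural hcomm hcentral hstar _ _
      (he _ _ twoTowers_isConnected twoTowers_isReduced twoTowers_isConnected
        twoTowers_isReduced towerHom)
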